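/- Fix a constant $0<\delta<1$. In the deterministic MPC model, an input array of $n$ words is distributed in blocks of $\lceil n^\delta\rceil$ consecutive words over $\lceil n/\lceil n^\delta\rceil\rceil=\Theta(n^{1-\delta})$ machines. Each machine has $O(n^\delta)$ words of local memory. In each round it performs arbitrary local computation (which may depend on $n$, the machine and the round), and then sends at most $O(n^\delta)$ words to, and receives at most $O(n^\delta)$ words from, other machines. A word is a natural number smaller than $n^{c}$ for a constant $c$, i.e. it has $O(\log n)$ bits. A rooted tree is represented by a properly nested string of opening and closing tags: the string of a tree whose root has tag $x$ and whose children's subtrees have strings $s_1,\dots,s_m$ is $\langle x\rangle\, s_1 \cdots s_m\, \langle/x\rangle$; if all tags are equal, this is a string of parentheses, a leaf being "()". A list of edges of the tree is a list that contains, exactly once and in any order, the pair (child, parent) for each non-root node; here a node is named by the position of its opening tag in the string. Then there are constants $R$ and $C$, depending only on $\delta$, such that for every constant $a$ there are a constant $c$ and a deterministic MPC algorithm with the following property. For every rooted tree whose string has length $n$ (one word per element) and whose tags are smaller than $n^{a}$ (for $a=0$: strings of parentheses), given the string as its distributed input, the algorithm runs for $R=O(1)$ rounds, in which every machine stores at most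 $C\lceil n^\delta\rceil$ words and sends and receives at most $C\lceil n^\delta\rceil$ words per round, all words being smaller than $n^{c}$; at the end, the machines together hold a list of the directed child–parent edges of the tree, each edge being stored as two consecutive words on a single machine. -/

import Mathlib

/-! ### Rooted trees and their two representations -/

/-- A finite rooted ordered tree in which every node carries a tag (a natural number).
The node is given by its tag and the list of the subtrees hanging from its children. -/
inductive TagTree : Type where
  | node (tag : ℕ) (children : List TagTree) : TagTree

/-- One element of a string of tags: `isOpen = true` is the opening tag `<tag>`,
`isOpen = false` is the closing tag `</tag>`. If all tags are equal these are the two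
parentheses. -/
structure Token where
  isOpen : Bool
  tag : ℕ

/-- A token occupies one word; for tag `0` this is `1` for an opening and `0` for a closing
parenthesis. -/
def Token.toWord (x : Token) : ℕ := 2 * x.tag + (if x.isOpen then 1 else 0)

namespace TagTree

mutual

/-- The properly nested string that represents a tree: the opening tag of the root, the strings
of its children from left to right, the closing tag of the root. -/
def tagString : TagTree → List Token
  | node a cs => [⟨true, a⟩] ++ forestString cs ++ [⟨false, a⟩]

/-- The concatenation of the strings of a list of trees. -/
def forestString : List TagTree → List Token
  | [] => []
  | T :: Ts => tagString T ++ forestString Ts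

end

mutual

/-- The directed edges `(child, parent)` of a tree whose string starts at position `p` of the
whole array. A node is identified with the position of its opening tag in the array. -/
def edgesFrom (p : ℕ) : TagTree → List (ℕ × ℕ)
  | node _ cs => forestEdges p (p + 1) cs

/-- The edges contributed by the trees of a list, when their roots are children of the node `r`
and the string of the first of them starts at position `p`. -/
def forestEdges (r p : ℕ) : List TagTree → List (ℕ × ℕ)
  | [] => []
  | T :: Ts => (p, r) :: (edgesFrom p T ++ forestEdges r (p + (tagString T).length) Ts)

end

/-- All edges `(child, parent)` of a tree; nodes are identified with the positions (from `0`) of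
their opening tags in `T.tagString`. -/
def edges (T : TagTree) : List (ℕ × ℕ) := edgesFrom 0 T

end TagTree

/-! ### Massively parallel computation -/

/-- A deterministic MPC algorithm on `M` machines. `send t i mem j` is the list of words that
machine `i`, when its memory contains `mem` at the beginning of round `t`, sends to machine `j` in
that round. Local computation is not restricted. A machine keeps data by sending it to itself. -/
structure MPCAlgorithm (M : ℕ) where
  send : ℕ → Fin M → List ℕ → Fin M → List ℕ

namespace MPCAlgorithm

variable {M : ℕ}

/-- `P.memory init t i` is the memory of machine `i` after `t` rounds: the words that it received
in the last round, in the order of the senders. -/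
def memory (P : MPCAlgorithm M) (init : Fin M → List ℕ) : ℕ → Fin M → List ℕ
  | 0, i => init i
  | t + 1, j => (List.finRange M).flatMap fun i => P.send t i (P.memory init t i) j

/-- The number of words that machine `i` sends in round `t`. -/
def sent (P : MPCAlgorithm M) (init : Fin M → List ℕ) (t : ℕ) (i : Fin M) : ℕ :=
  ∑ j : Fin M, (P.send t i (P.memory init t i) j).length

/-- In the first `R` rounds no machine ever stores or receives more than `S` words (its memory
after a round is what it received), no machine sends more than `S` words in a round, and all words
are smaller than `W`. -/
def WithinLimits (P : MPCAlgorithm M) (init : Fin M → List ℕ) (R S W : ℕ) : Prop :=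
  (∀ t ≤ R, ∀ i, (P.memory init t i).length ≤ S ∧ ∀ w ∈ P.memory init t i, w < W) ∧
    ∀ t < R, ∀ i, P.sent init t i ≤ S

end MPCAlgorithm

/-- The number `⌈n ^ δ⌉` of input words that each machine gets. -/
noncomputable def chunkSize (δ : ℝ) (n : ℕ) : ℕ := ⌈(n : ℝ) ^ δ⌉₊

/-- The number `⌈n / ⌈n ^ δ⌉⌉` of machines. -/
noncomputable def machineCount (δ : ℝ) (n : ℕ) : ℕ := n ⌈/⌉ chunkSize δ n

/-- Machine `i` initially holds the `i`-th block of `⌈n ^ δ⌉` consecutive words of the array. -/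
noncomputable def distribute (δ : ℝ) (n : ℕ) (A : List ℕ) : Fin (machineCount δ n) → List ℕ :=
  fun i => (A.drop (i * chunkSize δ n)).take (chunkSize δ n)

/-- The machines jointly hold the list of edges `E`, in some order, every machine storing each of
its edges `(child, parent)` as two consecutive words. -/
def HoldsEdges {M : ℕ} (mem : Fin M → List ℕ) (E : List (ℕ × ℕ)) : Prop :=
  ∃ out : Fin M → List (ℕ × ℕ),
    (∀ i, mem i = (out i).flatMap fun e => [e.1, e.2]) ∧
      ((List.finRange M).flatMap out).Perm E

-- Composition of algorithms

namespace MPCAlgorithm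

variable {M : ℕ}

-- The depth of the node opened at position `p` is twice the number of opening tags before `p`,
-- minus `p`, so prefix counts yield all depths (`TagTree.depth_openers_tagString`). The parent of
-- `c` is the last node before `c` whose depth is one less than that of `c`, since every node opened
-- strictly between the two is deeper than the parent (`TagTree.parent_spec`).
--
-- Let every node occur once as a parent, at its own depth, and, unless it is the root, once as a
-- child, at the depth of its parent. When these items are sorted by level and then by position, the
-- parent of `c` is the last parent item before the child item of `c` (`foundParent_eq`). A prefix
-- maximum over the sorted sequence therefore gives all edges.
--
-- The sort is a radix sort, least significant digit first, in base `b = ⌈n ^ (δ / 2)⌉`; `D = ⌈2 /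
-- δ⌉` digits suffice (`le_fanOut_pow`). In each pass the new rank of an item is a sum of counts
-- (`rank_refine`) that follow from prefix and suffix sums of digit-count tables
-- (`Steps.radixPass`). A table has `b` entries and a machine combines at most `b` tables at a time,
-- which fits because `b * b` is `O(n ^ δ)` (`fanOut_mul_self_le`). The combined windows of machines
-- grow by the factor `b`, so `D` enlargements cover all machines (`Steps.scan`).
--
-- Algorithms are not written out. Memories and messages are described as functions of an unknown
-- input, and a message is legitimate as soon as inputs that look alike to the sender give the same
-- message (`Steps.of_messages`).

theorem memory_congr {P Q : MPCAlgorithm M} {init : Fin M → List ℕ} {r : ℕ}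
    (h : ∀ t < r, P.send t = Q.send t) : ∀ t ≤ r, P.memory init t = Q.memory init t
  | 0, _ => rfl
  | t + 1, ht => by
    have ih := memory_congr (init := init) h t (by omega)
    funext j
    simp only [memory, ih, h t (by omega)]

theorem memory_add {P Q : MPCAlgorithm M} {init : Fin M → List ℕ} {r : ℕ}
    (h : ∀ t, P.send (r + t) = Q.send t) :
    ∀ t, P.memory init (r + t) = Q.memory (P.memory init r) t
  | 0 => rfl
  | t + 1 => by
    have ih := memory_add (init := init) h t
    funext j
    change (List.finRange M).flatMap (fun i => P.send (r + t) i (P.memory init (r + t) i) j) = _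
    rw [ih, h t]
    rfl

/-- In `r` rounds an algorithm can turn every initial memory that satisfies `X w` into one that
satisfies `Y w`, whatever the unknown input `w` is. -/
def Realizes {Ω : Type*} (r S W : ℕ) (X Y : Ω → (Fin M → List ℕ) → Prop) : Prop :=
  ∃ P : MPCAlgorithm M, ∀ w init, X w init → P.WithinLimits init r S W ∧ Y w (P.memory init r)

variable {Ω : Type*} {S W : ℕ}

/-- The second algorithm runs after the first, with its clock started at `r₁`. -/
theorem Realizes.trans {r₁ r₂ : ℕ} {X Y Z : Ω → (Fin M → List ℕ) → Prop}
    (h₁ : Realizes r₁ S W X Y) (h₂ : Realizes r₂ S W Y Z) : Realizes (r₁ + r₂) S W X Z := by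
  obtain ⟨P, hP⟩ := h₁
  obtain ⟨Q, hQ⟩ := h₂
  refine ⟨⟨fun t => if t < r₁ then P.send t else Q.send (t - r₁)⟩, fun w init hX => ?_⟩
  set A : MPCAlgorithm M := ⟨fun t => if t < r₁ then P.send t else Q.send (t - r₁)⟩ with hA
  obtain ⟨⟨hP1, hP2⟩, hY⟩ := hP w init hX
  obtain ⟨⟨hQ1, hQ2⟩, hZ⟩ := hQ w _ hY
  have e₁ : ∀ t ≤ r₁, A.memory init t = P.memory init t :=
    memory_congr fun t ht => by simp [hA, ht]
  have e₂ : ∀ t, A.memory init (r₁ + t) = Q.memory (P.memory init r₁) t := fun t => by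
    rw [← e₁ r₁ le_rfl]
    exact memory_add (fun t => by simp [hA]) t
  refine ⟨⟨fun t ht i => ?_, fun t ht i => ?_⟩, by rwa [e₂]⟩
  · rcases le_total t r₁ with h | h
    · rw [e₁ t h]; exact hP1 t h i
    · obtain ⟨u, rfl⟩ := Nat.exists_eq_add_of_le h
      rw [e₂]; exact hQ1 u (by omega) i
  · rcases lt_or_ge t r₁ with h | h
    · have := hP2 t h i
      unfold sent at this ⊢
      rw [e₁ t h.le]
      simpa [hA, h] using this
    · obtain ⟨u, rfl⟩ := Nat.exists_eq_add_of_le h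
      have := hQ2 u (by omega) i
      unfold sent at this ⊢
      rw [e₂]
      simpa [hA] using this

theorem Realizes.mono {r S' W' : ℕ} {X Y : Ω → (Fin M → List ℕ) → Prop}
    (h : Realizes r S W X Y) (hS : S ≤ S') (hW : W ≤ W') : Realizes r S' W' X Y := by
  obtain ⟨P, hP⟩ := h
  refine ⟨P, fun w init hX => ?_⟩
  obtain ⟨⟨h1, h2⟩, hY⟩ := hP w init hX
  exact ⟨⟨fun t ht i => ⟨(h1 t ht i).1.trans hS, fun x hx => ((h1 t ht i).2 x hx).trans_le hW⟩,
    fun t ht i => (h2 t ht i).trans hS⟩, hY⟩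

/-- A single round, given by what every machine sends. -/
theorem Realizes.of_send {X Y : Ω → (Fin M → List ℕ) → Prop}
    (send : Fin M → List ℕ → Fin M → List ℕ)
    (hX : ∀ w init, X w init → ∀ i, (init i).length ≤ S ∧ ∀ x ∈ init i, x < W)
    (hsent : ∀ w init, X w init → ∀ i, ∑ j, (send i (init i) j).length ≤ S)
    (hrec : ∀ w init, X w init → ∀ j,
      ((List.finRange M).flatMap fun i => send i (init i) j).length ≤ S ∧
        ∀ x ∈ (List.finRange M).flatMap fun i => send i (init i) j, x < W)
    (hY : ∀ w init, X w init →
      Y w (fun j => (List.finRange M).flatMap fun i => send i (init i) j)) :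
    Realizes 1 S W X Y := by
  refine ⟨⟨fun _ => send⟩, fun w init h => ⟨⟨fun t ht i => ?_, fun t ht i => ?_⟩, hY w init h⟩⟩
  · rcases Nat.le_one_iff_eq_zero_or_eq_one.1 ht with rfl | rfl
    · exact hX w init h i
    · exact hrec w init h i
  · obtain rfl : t = 0 := by omega
    exact hsent w init h i

/-! ### Machines whose memory is a collection of records -/

/-- The memory of a machine seen as three collections of pairs of numbers. -/
abbrev Registers := Multiset (ℕ × ℕ) × Multiset (ℕ × ℕ) × Multiset (ℕ × ℕ)

namespace Registers

/-- A word that stores the pair `x` with the label `l`. -/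
def encode (l : ℕ) (x : ℕ × ℕ) : ℕ := Nat.pair l (Nat.pair x.1 x.2)

/-- Pairing squares the bound, and the encoding nests two pairings; hence the word bound `V ^ 4` in
`Steps`. -/
theorem encode_lt {l V : ℕ} {x : ℕ × ℕ} (hl : l < V) (h1 : x.1 < V) (h2 : x.2 < V) :
    encode l x < V ^ 4 := by
  have key : ∀ {a b B : ℕ}, a < B → b < B → Nat.pair a b < B ^ 2 := fun {a b B} ha hb =>
    (Nat.pair_lt_max_add_one_sq a b).trans_le (Nat.pow_le_pow_left (by simp; omega) 2)
  have hV : V ≤ V ^ 2 := Nat.le_self_pow two_ne_zero V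
  calc encode l x < (V ^ 2) ^ 2 := key (hl.trans_le hV) (key h1 h2)
    _ = V ^ 4 := by ring

/-- The words that store the contents of the registers. -/
def words (s : Registers) : Multiset ℕ :=
  s.1.map (encode 0) + s.2.1.map (encode 1) + s.2.2.map (encode 2)

/-- The register with label `l` that is stored by the words `m`. -/
def read (l : ℕ) (m : Multiset ℕ) : Multiset (ℕ × ℕ) :=
  (m.filter fun x => x.unpair.1 = l).map fun x => x.unpair.2.unpair

theorem read_add (l : ℕ) (m m' : Multiset ℕ) : read l (m + m') = read l m + read l m' := by
  simp [read, Multiset.filter_add]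

theorem read_map_encode (l k : ℕ) (m : Multiset (ℕ × ℕ)) :
    read l (m.map (encode k)) = if k = l then m else 0 := by
  unfold read
  split_ifs with h
  · rw [Multiset.filter_eq_self.2]
    · simp [encode]
    · rintro _ hx
      obtain ⟨y, -, rfl⟩ := Multiset.mem_map.1 hx
      simp [encode, h]
  · rw [Multiset.filter_eq_nil.2]
    · simp
    · rintro _ hx
      obtain ⟨y, -, rfl⟩ := Multiset.mem_map.1 hx
      simp [encode, h]

/-- The labels separate the three registers, so a machine can decode its memory without regard to
the order of the words. -/
theorem words_injective : Function.Injective words := by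
  have h : Function.LeftInverse (fun m => (read 0 m, read 1 m, read 2 m)) words := fun s => by
    simp [words, read_add, read_map_encode]
  exact h.injective

/-- The number of records. -/
def size (s : Registers) : ℕ := s.1.card + s.2.1.card + s.2.2.card

theorem words_add (s t : Registers) : words (s + t) = words s + words t := by
  simp only [words, Prod.fst_add, Prod.snd_add, Multiset.map_add]
  abel

theorem words_zero : words 0 = 0 := rfl

theorem words_sum {ι : Type*} (t : Finset ι) (f : ι → Registers) :
    words (∑ i ∈ t, f i) = ∑ i ∈ t, words (f i) :=
  map_sum (⟨⟨words, words_zero⟩, words_add⟩ : Registers →+ Multiset ℕ) f t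

theorem card_words (s : Registers) : s.words.card = s.size := by simp [words, size]

/-- The registers hold at most `S` records, with entries below `V`. -/
structure Fits (S V : ℕ) (s : Registers) : Prop where
  size_le : s.size ≤ S
  lt₀ : ∀ x ∈ s.1, x.1 < V ∧ x.2 < V
  lt₁ : ∀ x ∈ s.2.1, x.1 < V ∧ x.2 < V
  lt₂ : ∀ x ∈ s.2.2, x.1 < V ∧ x.2 < V

theorem Fits.words_lt {V : ℕ} {s : Registers} (h : Fits S V s) (hV : 2 < V) :
    ∀ x ∈ s.words, x < V ^ 4 := by
  intro x hx
  simp only [words, Multiset.mem_add, Multiset.mem_map] at hx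
  rcases hx with (⟨y, hy, rfl⟩ | ⟨y, hy, rfl⟩) | ⟨y, hy, rfl⟩
  · exact encode_lt (by omega) (h.lt₀ y hy).1 (h.lt₀ y hy).2
  · exact encode_lt (by omega) (h.lt₁ y hy).1 (h.lt₁ y hy).2
  · exact encode_lt hV (h.lt₂ y hy).1 (h.lt₂ y hy).2

end Registers

/-- On input `w`, the memory of machine `i` consists of the records of `X w i`. -/
def Stores (X : Ω → Fin M → Registers) (w : Ω) (mem : Fin M → List ℕ) : Prop :=
  ∀ i, (mem i : Multiset ℕ) = (X w i).words

theorem coe_flatMap_finRange {α : Type*} (f : Fin M → List α) :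
    (((List.finRange M).flatMap f : List α) : Multiset α) = ∑ i, (f i : Multiset α) := by
  rw [← Multiset.coe_bind]
  rfl

/-- `Realizes` for memories that consist of records. -/
abbrev Steps (r S V : ℕ) (X Y : Ω → Fin M → Registers) : Prop :=
  Realizes r S (V ^ 4) (Stores X) (Stores Y)

variable {V : ℕ} {X Y : Ω → Fin M → Registers}

theorem Stores.limits (hV : 2 < V) (hX : ∀ w i, (X w i).Fits S V) {w : Ω} {init : Fin M → List ℕ}
    (h : Stores X w init) (i : Fin M) :
    (init i).length ≤ S ∧ ∀ x ∈ init i, x < V ^ 4 := by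
  refine ⟨?_, fun x hx => (hX w i).words_lt hV x ?_⟩
  · rw [← Multiset.coe_card, h i, Registers.card_words]; exact (hX w i).size_le
  · rw [← h i]; exact hx

theorem Steps.refl (hV : 2 < V) (hX : ∀ w i, (X w i).Fits S V) : Steps 0 S V X X := by
  refine ⟨⟨fun _ _ _ _ => []⟩, fun w init h => ⟨⟨fun t ht i => ?_, fun t ht => ?_⟩, h⟩⟩
  · obtain rfl : t = 0 := by omega
    exact h.limits hV hX i
  · omega

/-- A round in which the messages of a machine depend on its registers only. -/
theorem Steps.of_messages (msg : Ω → Fin M → Fin M → Registers) (hV : 2 < V)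
    (hX : ∀ w i, (X w i).Fits S V) (hY : ∀ w i, (Y w i).Fits S V)
    (hmsg : ∀ w w' i, X w i = X w' i → msg w i = msg w' i)
    (hsum : ∀ w j, ∑ i, msg w i j = Y w j)
    (hsent : ∀ w i, ∑ j, (msg w i j).size ≤ S) : Steps 1 S V X Y := by
  classical
  -- The machine decodes with an arbitrary input compatible with its memory; by `hmsg` the choice
  -- does not affect the messages.
  let send : Fin M → List ℕ → Fin M → List ℕ := fun i l j =>
    if h : ∃ w, (l : Multiset ℕ) = (X w i).words then (msg h.choose i j).words.toList else []
  have hsend : ∀ w init, Stores X w init → ∀ i j,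
      ((send i (init i) j : List ℕ) : Multiset ℕ) = (msg w i j).words := by
    intro w init h i j
    have hex : ∃ w, (init i : Multiset ℕ) = (X w i).words := ⟨w, h i⟩
    simp only [send, dif_pos hex, Multiset.coe_toList]
    rw [hmsg hex.choose w i]
    exact Registers.words_injective (hex.choose_spec.symm.trans (h i))
  have hst : ∀ w init, Stores X w init →
      Stores Y w (fun j => (List.finRange M).flatMap fun i => send i (init i) j) := by
    intro w init h j
    rw [coe_flatMap_finRange, ← hsum, Registers.words_sum]
    exact Finset.sum_congr rfl fun i _ => hsend w init h i j
  refine Realizes.of_send send (fun w init h => h.limits hV hX) (fun w init h i => ?_)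
    (fun w init h => (hst w init h).limits hV hY) hst
  calc ∑ j, (send i (init i) j).length = ∑ j, (msg w i j).size :=
        Finset.sum_congr rfl fun j _ => by
          rw [← Multiset.coe_card, hsend w init h, Registers.card_words]
    _ ≤ S := hsent w i

/-- A round of local computation. -/
theorem Steps.of_local (hV : 2 < V) (hX : ∀ w i, (X w i).Fits S V)
    (hY : ∀ w i, (Y w i).Fits S V) (h : ∀ w w' i, X w i = X w' i → Y w i = Y w' i) :
    Steps 1 S V X Y := by
  classical
  refine Steps.of_messages (fun w i j => if i = j then Y w i else 0) hV hX hY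
    (fun w w' i hi => ?_) (fun w j => ?_) (fun w i => ?_)
  · simp only [h w w' i hi]
  · simp
  · have : ∀ j, (if i = j then Y w i else 0 : Registers).size =
        if i = j then (Y w i).size else 0 := fun j => by split_ifs <;> rfl
    simpa [this] using (hY w i).size_le

theorem Steps.iterate {r : ℕ} (Z : ℕ → Ω → Fin M → Registers) (hV : 2 < V)
    (hZ : ∀ w i, (Z 0 w i).Fits S V) :
    ∀ k, (∀ l < k, Steps r S V (Z l) (Z (l + 1))) → Steps (k * r) S V (Z 0) (Z k)
  | 0, _ => by simpa using Steps.refl hV hZ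
  | k + 1, h => by
    rw [Nat.succ_mul]
    exact (Steps.iterate Z hV hZ k fun l hl => h l (by omega)).trans (h k (by omega))

end MPCAlgorithm

namespace MPCAlgorithm

/-! ### Prefix computations -/

/-- The records `(v, h v)` for `v < L`. -/
def table (L : ℕ) (h : ℕ → ℕ) : Multiset (ℕ × ℕ) := (Multiset.range L).map fun v => (v, h v)

/-- The aggregate of the values stored under the key `v`. -/
def lookup (g : Multiset ℕ → ℕ) (m : Multiset (ℕ × ℕ)) (v : ℕ) : ℕ :=
  g ((m.filter fun x => x.1 = v).map Prod.snd)

theorem card_table (L : ℕ) (h : ℕ → ℕ) : (table L h).card = L := by simp [table]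

theorem mem_table {L : ℕ} {h : ℕ → ℕ} {x : ℕ × ℕ} : x ∈ table L h ↔ x.1 < L ∧ x.2 = h x.1 := by
  obtain ⟨a, b⟩ := x
  simp only [table, Multiset.mem_map, Multiset.mem_range, Prod.mk.injEq]
  constructor
  · rintro ⟨v, hv, rfl, rfl⟩; exact ⟨hv, rfl⟩
  · rintro ⟨hv, rfl⟩; exact ⟨a, hv, rfl, rfl⟩

theorem table_congr {L : ℕ} {h h' : ℕ → ℕ} (H : ∀ v < L, h v = h' v) : table L h = table L h' :=
  Multiset.map_congr rfl fun v hv => by rw [H v (Multiset.mem_range.1 hv)]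

theorem eq_of_table_eq {L : ℕ} {h h' : ℕ → ℕ} (H : table L h = table L h') {v : ℕ} (hv : v < L) :
    h v = h' v := by
  have : (v, h v) ∈ table L h' := H ▸ mem_table.2 ⟨hv, rfl⟩
  exact (mem_table.1 this).2

theorem filter_table {L : ℕ} {h : ℕ → ℕ} {v : ℕ} (hv : v < L) :
    (table L h).filter (fun x => x.1 = v) = {(v, h v)} := by
  have hnd : (table L h).Nodup :=
    (Multiset.nodup_range L).map fun a b hab => (Prod.mk.inj hab).1
  refine (Multiset.Nodup.ext (hnd.filter _) (Multiset.nodup_singleton _)).2 fun x => ?_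
  rw [Multiset.mem_filter, mem_table, Multiset.mem_singleton]
  constructor
  · rintro ⟨⟨-, h2⟩, rfl⟩; exact Prod.ext rfl h2
  · rintro rfl; exact ⟨⟨hv, rfl⟩, rfl⟩

/-- Each table contributes exactly one value under the key `v`, so tables merged into one multiset
can still be aggregated entry by entry. -/
theorem lookup_sum_table {ι : Type*} (g : Multiset ℕ → ℕ) (t : Finset ι) (h : ι → ℕ → ℕ)
    {L v : ℕ} (hv : v < L) :
    lookup g (∑ i ∈ t, table L (h i)) v = g (t.val.map fun i => h i v) := by
  classical
  unfold lookup
  congr 1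
  induction t using Finset.induction_on with
  | empty => simp
  | insert i t hi ih =>
    rw [Finset.sum_insert hi, Multiset.filter_add, Multiset.map_add, ih, filter_table hv,
      Finset.insert_val_of_notMem hi]
    simp

variable {M : ℕ} {Ω : Type*} {S V : ℕ}

/-- Along the order `e` of the machines, every machine receives a table from the machines at the
distances in `O` before it, and aggregates these tables. -/
theorem Steps.gather (e : Equiv.Perm (Fin M)) (O : Finset ℕ) (hO : O.Nonempty) {L S₀ : ℕ}
    (g : Multiset ℕ → ℕ) (A U Z : Ω → Fin M → Multiset (ℕ × ℕ)) (h : Ω → Fin M → ℕ → ℕ)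
    (hdet : ∀ w w' i, A w i = A w' i → U w i = U w' i → Z w i = Z w' i →
      ∀ v < L, h w i v = h w' i v)
    (hV : 2 < V) (hLV : L ≤ V) (hS : S₀ + O.card * L ≤ S)
    (hAU : ∀ w i, Registers.Fits S₀ V (A w i, U w i, 0))
    (hZ : ∀ w i, Registers.Fits S V (A w i, U w i, Z w i))
    (hh : ∀ w i, ∀ v < L, h w i v < V)
    (hg : ∀ w (j : Fin M), ∀ v < L,
      g ((Finset.univ.filter fun i => ∃ o ∈ O, (e i : ℕ) + o = e j).val.map fun i => h w i v) < V) :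
    Steps 2 S V (fun w i => (A w i, U w i, Z w i)) (fun w j => (A w j, U w j, table L fun v =>
      g ((Finset.univ.filter fun i => ∃ o ∈ O, (e i : ℕ) + o = e j).val.map
        fun i => h w i v))) := by
  classical
  set N : Fin M → Finset (Fin M) :=
    fun j => Finset.univ.filter fun i => ∃ o ∈ O, (e i : ℕ) + o = e j with hN
  -- For a fixed receiver the distance determines the sender, and conversely; so `O.card` bounds
  -- both the senders and the receivers of a machine.
  have cardN : ∀ j, (N j).card ≤ O.card := fun j => by
    refine Finset.card_le_card_of_injOn (fun i => (e j : ℕ) - e i) (fun i hi => ?_)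
      (fun i hi i' hi' hii => ?_)
    · obtain ⟨o, ho, h1⟩ := (Finset.mem_filter.1 hi).2
      have : (e j : ℕ) - e i = o := by omega
      simpa [this] using ho
    · obtain ⟨o, -, h1⟩ := (Finset.mem_filter.1 hi).2
      obtain ⟨o', -, h1'⟩ := (Finset.mem_filter.1 hi').2
      simp only at hii
      exact e.injective (Fin.ext (by omega))
  have cardN' : ∀ i, (Finset.univ.filter fun j => i ∈ N j).card ≤ O.card := fun i => by
    refine Finset.card_le_card_of_injOn (fun j => (e j : ℕ) - e i) (fun j hj => ?_)
      (fun j hj j' hj' hjj => ?_)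
    · obtain ⟨o, ho, h1⟩ := (Finset.mem_filter.1 (Finset.mem_filter.1 hj).2).2
      have : (e j : ℕ) - e i = o := by omega
      simpa [this] using ho
    · obtain ⟨o, -, h1⟩ := (Finset.mem_filter.1 (Finset.mem_filter.1 hj).2).2
      obtain ⟨o', -, h1'⟩ := (Finset.mem_filter.1 (Finset.mem_filter.1 hj').2).2
      simp only at hjj
      exact e.injective (Fin.ext (by omega))
  have size₀ : ∀ w i, (A w i).card + (U w i).card ≤ S₀ := fun w i => by
    simpa [Registers.size] using (hAU w i).size_le
  have hmid : ∀ w j, Registers.Fits S V (A w j, U w j, ∑ i ∈ N j, table L (h w i)) := by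
    intro w j
    refine ⟨?_, (hAU w j).lt₀, (hAU w j).lt₁, fun x hx => ?_⟩
    · have h1 : (∑ i ∈ N j, table L (h w i)).card = (N j).card * L := by
        rw [Multiset.card_sum]; simp [card_table]
      have := Nat.mul_le_mul_right L (cardN j)
      have := size₀ w j
      simp only [Registers.size, h1]
      omega
    · change x ∈ ∑ i ∈ N j, table L (h w i) at hx
      obtain ⟨i, -, hi⟩ := Multiset.mem_sum.1 hx
      obtain ⟨h1, h2⟩ := mem_table.1 hi
      exact ⟨h1.trans_le hLV, h2 ▸ hh w i _ h1⟩
  have spread : Steps 1 S V (fun w i => (A w i, U w i, Z w i))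
      (fun w j => (A w j, U w j, ∑ i ∈ N j, table L (h w i))) := by
    refine Steps.of_messages (fun w i j => (if i = j then A w i else 0, if i = j then U w i else 0,
      if i ∈ N j then table L (h w i) else 0)) hV hZ hmid (fun w w' i hi => ?_) (fun w j => ?_)
      (fun w i => ?_)
    · simp only [Prod.mk.injEq] at hi
      obtain ⟨h1, h2, h3⟩ := hi
      funext j
      rw [h1, h2, table_congr (hdet w w' i h1 h2 h3)]
    · refine Prod.ext ?_ (Prod.ext ?_ ?_)
      · simp [Prod.fst_sum]
      · simp [Prod.fst_sum, Prod.snd_sum]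
      · simp only [Prod.snd_sum]
        rw [← Finset.sum_filter]
        simp
    · have : ∀ j, Registers.size (if i = j then A w i else 0, if i = j then U w i else 0,
          if i ∈ N j then table L (h w i) else 0) =
          (if i = j then (A w i).card + (U w i).card else 0) + if i ∈ N j then L else 0 := by
        intro j
        simp only [Registers.size]
        split_ifs <;> simp [card_table]
      simp only [this, Finset.sum_add_distrib]
      rw [← Finset.sum_filter (fun j => i ∈ N j)]
      have h1 := Nat.mul_le_mul_right L (cardN' i)
      have h2 := size₀ w i
      simp
      omega
  refine spread.trans (Steps.of_local hV hmid (fun w j => ?_) fun w w' j hj => ?_)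
  · refine ⟨?_, (hAU w j).lt₀, (hAU w j).lt₁, fun x hx => ?_⟩
    · have h1 := Nat.le_mul_of_pos_left L hO.card_pos
      have := size₀ w j
      simp only [Registers.size, card_table]
      omega
    · obtain ⟨h1, h2⟩ := mem_table.1 hx
      exact ⟨h1.trans_le hLV, h2 ▸ hg w j _ h1⟩
  · simp only [Prod.mk.injEq] at hj ⊢
    refine ⟨hj.1, hj.2.1, table_congr fun v hv => ?_⟩
    rw [← lookup_sum_table g _ (h w) hv, ← lookup_sum_table g _ (h w') hv, hj.2.2]

/-- Exclusive prefix computations along the order `e` of the machines. -/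
theorem Steps.scan (e : Equiv.Perm (Fin M)) {f D L S₀ : ℕ} (g : Multiset ℕ → ℕ)
    (hg₁ : ∀ x, g {x} = x)
    (hgb : ∀ (s : Multiset (Fin M)) (m : Fin M → Multiset ℕ),
      g (s.bind m) = g (s.map fun i => g (m i)))
    (A U : Ω → Fin M → Multiset (ℕ × ℕ)) (a : Ω → Fin M → ℕ → ℕ)
    (hdet : ∀ w w' i, A w i = A w' i → U w i = U w' i → ∀ v < L, a w i v = a w' i v)
    (hV : 2 < V) (hLV : L ≤ V) (hf : 0 < f) (hS : S₀ + f * L ≤ S) (hM : M ≤ f ^ D)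
    (hAU : ∀ w i, Registers.Fits S₀ V (A w i, U w i, 0))
    (hg : ∀ w, ∀ v < L, ∀ t : Finset (Fin M), g (t.val.map fun i => a w i v) < V) :
    Steps (2 + D * 2) S V (fun w i => (A w i, U w i, 0)) (fun w j => (A w j, U w j, table L fun v =>
      g ((Finset.univ.filter fun i => e i < e j).val.map fun i => a w i v))) := by
  classical
  -- The window of the `f ^ l` machines directly before `j`, cut off at the beginning of the order.
  let win : ℕ → Fin M → Finset (Fin M) := fun l j =>
    Finset.univ.filter fun i => e i < e j ∧ (e j : ℕ) ≤ e i + f ^ l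
  have mem_win : ∀ {l j i}, i ∈ win l j ↔ (e i : ℕ) < e j ∧ (e j : ℕ) ≤ e i + f ^ l := by
    intro l j i
    simp [win]
  let Z : ℕ → Ω → Fin M → Registers := fun l w j =>
    (A w j, U w j, table L fun v => g ((win l j).val.map fun i => a w i v))
  have size₀ : ∀ w i, (A w i).card + (U w i).card ≤ S₀ := fun w i => by
    simpa [Registers.size] using (hAU w i).size_le
  have fits : ∀ l w i, (Z l w i).Fits S V := fun l w i => by
    refine ⟨?_, (hAU w i).lt₀, (hAU w i).lt₁, fun x hx => ?_⟩
    · have h1 := Nat.le_mul_of_pos_left L hf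
      have := size₀ w i
      simp only [Registers.size, card_table, Z]
      omega
    · obtain ⟨h1, h2⟩ := mem_table.1 hx
      exact ⟨h1.trans_le hLV, h2 ▸ hg w _ h1 _⟩
  have first : Steps 2 S V (fun w i => (A w i, U w i, 0)) (Z 0) := by
    have ew : ∀ j, (Finset.univ.filter fun i => ∃ o ∈ ({1} : Finset ℕ), (e i : ℕ) + o = e j) =
        win 0 j := fun j => by
      ext i
      simp only [Finset.mem_filter, Finset.mem_univ, true_and, Finset.mem_singleton,
        exists_eq_left, mem_win, pow_zero]
      omega
    have := Steps.gather (S := S) e {1} (by simp) g A U (fun _ _ => 0) a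
      (fun w w' i h1 h2 _ => hdet w w' i h1 h2) hV hLV
      (by have := Nat.le_mul_of_pos_left L hf; simp; omega) hAU
      (fun w i => ⟨by have := size₀ w i; simp [Registers.size]; omega,
        (hAU w i).lt₀, (hAU w i).lt₁, (hAU w i).lt₂⟩)
      (fun w i v hv => by simpa [hg₁] using hg w v hv {i})
      (fun w j v hv => hg w v hv _)
    simpa only [ew] using this
  have next : ∀ l, Steps 2 S V (Z l) (Z (l + 1)) := by
    intro l
    have hfl : 0 < f ^ l := Nat.pow_pos hf
    -- The long window of `j` is tiled by the short windows of the machines at distances `k * f ^ l`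
    -- before `j`, for `k < f`; distance `0` is `j` itself.
    set O : Finset ℕ := (Finset.range f).image (· * f ^ l) with hO
    have hOc : O.card ≤ f := Finset.card_image_le.trans (by simp)
    have memO : ∀ {i j : Fin M}, (∃ o ∈ O, (e i : ℕ) + o = e j) ↔
        ∃ k < f, (e i : ℕ) + k * f ^ l = e j := by
      intro i j
      simp [hO]
    have hdisj : ∀ j, ((Finset.univ.filter fun i => ∃ o ∈ O, (e i : ℕ) + o = e j : Finset (Fin M)) :
        Set (Fin M)).PairwiseDisjoint (win l) := by
      intro j i hi i' hi' hne
      simp only [Finset.coe_filter, Finset.mem_univ, true_and, Set.mem_ofPred_eq, memO] at hi hi'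
      refine Finset.disjoint_left.2 fun x hx hx' => hne ?_
      rw [mem_win] at hx hx'
      obtain ⟨k, -, hk⟩ := hi
      obtain ⟨k', -, hk'⟩ := hi'
      have hkk : k = k' := by
        rcases lt_trichotomy k k' with h | h | h
        · have := Nat.mul_le_mul_right (f ^ l) (Nat.succ_le_of_lt h)
          rw [Nat.succ_mul] at this
          omega
        · exact h
        · have := Nat.mul_le_mul_right (f ^ l) (Nat.succ_le_of_lt h)
          rw [Nat.succ_mul] at this
          omega
      subst hkk
      exact e.injective (Fin.ext (by omega))
    have hwin : ∀ j, win (l + 1) j = (Finset.univ.filter fun i =>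
        ∃ o ∈ O, (e i : ℕ) + o = e j).disjiUnion (win l) (hdisj j) := by
      intro j
      ext x
      simp only [Finset.mem_disjiUnion, Finset.mem_filter, Finset.mem_univ, true_and, memO, mem_win]
      constructor
      · rintro ⟨h1, h2⟩
        -- The number of the tile that contains `x`. One is subtracted because a window holds the
        -- distances from `1` to `f ^ l`, not from `0`.
        have hk : ((e j : ℕ) - e x - 1) / f ^ l < f := by
          rw [Nat.div_lt_iff_lt_mul hfl, ← pow_succ']
          omega
        have hd := Nat.div_add_mod' ((e j : ℕ) - e x - 1) (f ^ l)
        have hm := Nat.mod_lt ((e j : ℕ) - e x - 1) hfl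
        generalize ((e j : ℕ) - e x - 1) % f ^ l = m at hd hm
        generalize ((e j : ℕ) - e x - 1) / f ^ l = k at hd hk
        have hlt : (e j : ℕ) - k * f ^ l < M := by have := (e j).isLt; omega
        refine ⟨e.symm ⟨_, hlt⟩, ⟨k, hk, ?_⟩, ?_⟩
        · simp only [Equiv.apply_symm_apply]; omega
        · simp only [Equiv.apply_symm_apply]; omega
      · rintro ⟨i, ⟨k, hk, h1⟩, h2, h3⟩
        have := Nat.mul_le_mul_right (f ^ l) (Nat.succ_le_of_lt hk)
        rw [Nat.succ_mul, ← pow_succ'] at this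
        omega
    have hval : ∀ w j v, g ((Finset.univ.filter fun i => ∃ o ∈ O, (e i : ℕ) + o = e j).val.map
        fun i => g ((win l i).val.map fun x => a w x v)) =
        g ((win (l + 1) j).val.map fun x => a w x v) := by
      intro w j v
      rw [← hgb, hwin, ← Multiset.map_bind]
      rfl
    have := Steps.gather (S := S) e O (by simpa [hO] using hf.ne') g A U
      (fun w j => table L fun v => g ((win l j).val.map fun i => a w i v))
      (fun w j v => g ((win l j).val.map fun i => a w i v))
      (fun w w' i _ _ h v hv => eq_of_table_eq h hv) hV hLV
      (by have := Nat.mul_le_mul_right L hOc; omega) hAU (fun w i => fits l w i)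
      (fun w i v hv => hg w v hv _)
      (fun w j v hv => by rw [hval]; exact hg w v hv _)
    simpa only [hval] using this
  have last : Z D = fun w j => (A w j, U w j, table L fun v =>
      g ((Finset.univ.filter fun i => e i < e j).val.map fun i => a w i v)) := by
    -- Since `M ≤ f ^ D`, the upper limit on the distance is no longer a restriction.
    have ew : ∀ j, win D j = Finset.univ.filter fun i => e i < e j := fun j => by
      ext i
      have := (e j).isLt
      simp only [mem_win, Finset.mem_filter, Finset.mem_univ, true_and, Fin.lt_def]
      omega
    funext w j
    simp only [Z, ew]
  rw [← last]
  exact first.trans (Steps.iterate Z hV (fits 0) D fun l _ => next l)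

end MPCAlgorithm

namespace MPCAlgorithm

/-! ### Stable radix sort -/

/-- The records `(h j, j)` of those `j ∈ J` that are located at `i`. -/
def place (J : Finset ℕ) (h loc : ℕ → ℕ) (i : ℕ) : Multiset (ℕ × ℕ) :=
  (J.filter fun j => loc j = i).val.map fun j => (h j, j)

theorem card_place (J : Finset ℕ) (h loc : ℕ → ℕ) (i : ℕ) :
    (place J h loc i).card = (J.filter fun j => loc j = i).card := Multiset.card_map _ _

theorem mem_place {J : Finset ℕ} {h loc : ℕ → ℕ} {i : ℕ} {x : ℕ × ℕ} :
    x ∈ place J h loc i ↔ x.2 ∈ J ∧ loc x.2 = i ∧ x.1 = h x.2 := by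
  obtain ⟨a, j⟩ := x
  simp only [place, Multiset.mem_map, Finset.mem_val, Finset.mem_filter, Prod.mk.injEq]
  constructor
  · rintro ⟨j, ⟨h1, h2⟩, rfl, rfl⟩; exact ⟨h1, h2, rfl⟩
  · rintro ⟨h1, h2, rfl⟩; exact ⟨j, ⟨h1, h2⟩, rfl, rfl⟩

/-- Together with `height_eq_of_place_eq`: whatever is expressed through the items on a machine and
their values can be computed there. -/
theorem filter_eq_of_place_eq {J J' : Finset ℕ} {h h' loc loc' : ℕ → ℕ} {i : ℕ}
    (H : place J h loc i = place J' h' loc' i) :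
    (J.filter fun j => loc j = i) = J'.filter fun j => loc' j = i := by
  have := congrArg (Multiset.map Prod.snd) H
  simp only [place, Multiset.map_map, Function.comp_def, Multiset.map_id'] at this
  exact Finset.val_injective this

theorem height_eq_of_place_eq {J J' : Finset ℕ} {h h' loc loc' : ℕ → ℕ} {i j : ℕ}
    (H : place J h loc i = place J' h' loc' i) (hj : j ∈ J.filter fun j => loc j = i) :
    h j = h' j := by
  have : (h j, j) ∈ place J' h' loc' i :=
    H ▸ mem_place.2 ⟨(Finset.mem_filter.1 hj).1, (Finset.mem_filter.1 hj).2, rfl⟩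
  exact (mem_place.1 this).2.2

theorem place_congr {J J' : Finset ℕ} {h h' loc loc' : ℕ → ℕ} {i : ℕ}
    (H : (J.filter fun j => loc j = i) = J'.filter fun j => loc' j = i)
    (Hh : ∀ j ∈ J.filter fun j => loc j = i, h j = h' j) :
    place J h loc i = place J' h' loc' i := by
  unfold place
  rw [← H]
  exact Multiset.map_congr rfl fun j hj => by rw [Hh j hj]

variable {M : ℕ}

/-- Every element has exactly one location, so it occurs once in the sum over the machines. -/
theorem sum_filter_map {β : Type*} {J : Finset ℕ} {loc : ℕ → ℕ} (hloc : ∀ j ∈ J, loc j < M)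
    (p : ℕ → Prop) [DecidablePred p] (f : ℕ → β) :
    ∑ i : Fin M, (J.filter fun j => loc j = i ∧ p j).val.map f = (J.filter p).val.map f := by
  have single : ∀ s : Finset ℕ, s.val.map f = ∑ x ∈ s, ({f x} : Multiset β) := fun s => by
    have : (s.val.map fun x => ({f x} : Multiset β)).sum = s.val.map f := by
      rw [← Multiset.sum_map_singleton (s.val.map f), Multiset.map_map]; rfl
    exact this.symm
  simp only [single, Finset.sum_filter]
  rw [Finset.sum_comm]
  refine Finset.sum_congr rfl fun j hj => ?_
  rw [Finset.sum_eq_single (⟨loc j, hloc j hj⟩ : Fin M)]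
  · simp
  · intro i _ hi
    rw [if_neg]
    rintro ⟨h, -⟩
    exact hi (Fin.ext h.symm)
  · simp

theorem sum_card_filter {J : Finset ℕ} {loc : ℕ → ℕ} (hloc : ∀ j ∈ J, loc j < M)
    (p : ℕ → Prop) [DecidablePred p] :
    ∑ i : Fin M, (J.filter fun j => loc j = i ∧ p j).card = (J.filter p).card := by
  have := congrArg Multiset.card (sum_filter_map hloc p id)
  simp only [Multiset.card_sum, Multiset.card_map] at this
  exact this

/-- The number of elements of `J` that have a smaller key than `j`. -/
def rank (J : Finset ℕ) (κ : ℕ → ℕ) (j : ℕ) : ℕ := (J.filter fun y => κ y < κ j).card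

theorem rank_lt_rank {J : Finset ℕ} {κ : ℕ → ℕ} {j j' : ℕ} (hj : j ∈ J) (h : κ j < κ j') :
    rank J κ j < rank J κ j' := by
  refine Finset.card_lt_card ⟨fun y hy => ?_, fun hss => ?_⟩
  · rw [Finset.mem_filter] at hy ⊢
    exact ⟨hy.1, hy.2.trans h⟩
  · have := hss (Finset.mem_filter.2 ⟨hj, h⟩)
    exact absurd (Finset.mem_filter.1 this).2 (lt_irrefl _)

theorem rank_lt_card {J : Finset ℕ} {κ : ℕ → ℕ} {j : ℕ} (hj : j ∈ J) : rank J κ j < J.card := by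
  refine Finset.card_lt_card ⟨Finset.filter_subset _ _, fun hss => ?_⟩
  exact absurd (Finset.mem_filter.1 (hss hj)).2 (lt_irrefl _)

/-- An injective key gives distinct ranks, and the ranks with quotient `i` lie in an interval of
length `S`. This balances the load after sorting. -/
theorem card_filter_rank_div {J : Finset ℕ} {κ : ℕ → ℕ} (hκ : Set.InjOn κ J) {S : ℕ} (hS : 0 < S)
    (i : ℕ) : (J.filter fun j => rank J κ j / S = i).card ≤ S := by
  have : (J.filter fun j => rank J κ j / S = i).card ≤ (Finset.Ico (i * S) (i * S + S)).card := by
    refine Finset.card_le_card_of_injOn (rank J κ) (fun j hj => ?_) (fun j hj j' hj' h => ?_)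
    · have h1 := (Finset.mem_filter.1 hj).2
      have h2 := Nat.div_add_mod' (rank J κ j) S
      have h3 := Nat.mod_lt (rank J κ j) hS
      rw [h1] at h2
      rw [Finset.mem_coe, Finset.mem_Ico]
      omega
    · have hj := (Finset.mem_filter.1 hj).1
      have hj' := (Finset.mem_filter.1 hj').1
      rcases lt_trichotomy (κ j) (κ j') with h1 | h1 | h1
      · exact absurd h (rank_lt_rank hj h1).ne
      · exact hκ hj hj' h1
      · exact absurd h (rank_lt_rank hj' h1).ne'
  simpa using this

/-- The rank for a key that is refined by a more significant digit `v`. -/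
theorem rank_refine {J : Finset ℕ} {κ κ' v loc : ℕ → ℕ} {Q j : ℕ} (hj : j ∈ J)
    (hQ : ∀ y ∈ J, κ y < Q) (hκ' : ∀ y, κ' y = v y * Q + κ y)
    (hmono : ∀ y ∈ J, ∀ y' ∈ J, loc y < loc y' → κ y < κ y') :
    rank J κ' j = (∑ u ∈ Finset.range (v j), (J.filter fun y => v y = u).card) +
      (J.filter fun y => loc y < loc j ∧ v y = v j).card +
      (J.filter fun y => loc y = loc j ∧ v y = v j ∧ κ y < κ j).card := by
  have h1 : (∑ u ∈ Finset.range (v j), (J.filter fun y => v y = u).card) =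
      (J.filter fun y => v y < v j).card := by
    rw [Finset.card_eq_sum_card_fiberwise (f := v) (t := Finset.range (v j))]
    · refine Finset.sum_congr rfl fun u hu => ?_
      rw [Finset.filter_filter]
      congr 1
      ext y
      have := Finset.mem_range.1 hu
      simp only [Finset.mem_filter]
      constructor
      · rintro ⟨h1, rfl⟩; exact ⟨h1, this, rfl⟩
      · rintro ⟨h1, -, h2⟩; exact ⟨h1, h2⟩
    · intro y hy
      have := (Finset.mem_filter.1 hy).2
      simpa using this
  rw [h1, rank]
  -- The identity holds for each `y` separately: a digit outweighs all of `κ` because `κ < Q`, and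
  -- for equal digits on different machines `hmono` decides the comparison.
  simp only [Finset.card_filter, ← Finset.sum_add_distrib]
  refine Finset.sum_congr rfl fun y hy => ?_
  have hy1 := hQ y hy
  have hj1 := hQ j hj
  have m1 := hmono y hy j hj
  have m2 := hmono j hj y hy
  rw [hκ', hκ']
  rcases lt_trichotomy (v y) (v j) with h | h | h
  · have := Nat.mul_le_mul_right Q (Nat.succ_le_of_lt h)
    rw [Nat.succ_mul] at this
    rw [if_pos (by omega), if_pos h, if_neg (by omega), if_neg (by omega)]
  · rw [h, if_neg (lt_irrefl (v j))]
    rcases lt_trichotomy (loc y) (loc j) with h' | h' | h'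
    · have := m1 h'
      rw [if_pos (by omega), if_pos ⟨h', rfl⟩, if_neg (by omega)]
    · by_cases hk : κ y < κ j
      · rw [if_pos (by omega), if_neg (by omega), if_pos ⟨h', rfl, hk⟩]
      · rw [if_neg (by omega), if_neg (by omega), if_neg (by omega)]
    · have := m2 h'
      rw [if_neg (by omega), if_neg (by omega), if_neg (by omega)]
  · have := Nat.mul_le_mul_right Q (Nat.succ_le_of_lt h)
    rw [Nat.succ_mul] at this
    rw [if_neg (by omega), if_neg (by omega), if_neg (by omega), if_neg (by omega)]

variable {Ω : Type*} {S V : ℕ}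

/-- A prefix scan, a suffix scan and the machine's own count give the total, so totals need not be
broadcast. -/
theorem card_filter_eq_sum_univ {J : Finset ℕ} {loc : ℕ → ℕ} (hloc : ∀ j ∈ J, loc j < M)
    (v : ℕ → ℕ) (u : ℕ) (i : Fin M) :
    (J.filter fun y => v y = u).card =
      (∑ k with k < i, (J.filter fun y => loc y = k ∧ v y = u).card) +
      (J.filter fun y => loc y = i ∧ v y = u).card +
      ∑ k with i < k, (J.filter fun y => loc y = k ∧ v y = u).card := by
  rw [← sum_card_filter hloc fun y => v y = u]
  set c : Fin M → ℕ := fun k => (J.filter fun y => loc y = k ∧ v y = u).card with hc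
  change ∑ k, c k = (∑ k with k < i, c k) + c i + ∑ k with i < k, c k
  have : c i = ∑ k, if k = i then c k else 0 := by simp
  rw [this, Finset.sum_filter, Finset.sum_filter, ← Finset.sum_add_distrib,
    ← Finset.sum_add_distrib]
  refine Finset.sum_congr rfl fun k _ => ?_
  rcases lt_trichotomy k i with h | h | h
  · simp [h, h.ne, h.not_gt]
  · simp [h]
  · simp [h, h.ne', h.not_gt]

theorem card_filter_lt_eq_sum {J : Finset ℕ} {loc : ℕ → ℕ} (hloc : ∀ j ∈ J, loc j < M)
    (v : ℕ → ℕ) (u : ℕ) (i : Fin M) :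
    (J.filter fun y => loc y < i ∧ v y = u).card =
      ∑ k with k < i, (J.filter fun y => loc y = k ∧ v y = u).card := by
  rw [← sum_card_filter hloc fun y => loc y < i ∧ v y = u, Finset.sum_filter]
  refine Finset.sum_congr rfl fun k _ => ?_
  split_ifs with h
  · congr 1
    refine Finset.filter_congr fun y _ => ⟨fun ⟨h1, _, h2⟩ => ⟨h1, h2⟩, fun ⟨h1, h2⟩ => ⟨h1, ?_, h2⟩⟩
    rw [h1]; exact h
  · rw [Finset.card_eq_zero, Finset.filter_eq_empty_iff]
    rintro y _ ⟨h1, h2, -⟩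
    exact h (by rw [h1] at h2; exact h2)

theorem sum_bind_eq (s : Multiset (Fin M)) (m : Fin M → Multiset ℕ) :
    (s.bind m).sum = (s.map fun i => (m i).sum).sum := Multiset.sum_bind s m

/-- One pass of radix sort: records that are sorted by `κ` become sorted by the refinement `κ'` of
this key by the digit `v`. -/
theorem Steps.radixPass {b D B : ℕ} (J : Ω → Finset ℕ) (h loc : Ω → ℕ → ℕ) (digit : ℕ → ℕ)
    (κ κ' : Ω → ℕ → ℕ) (sub : ℕ → ℕ → ℕ) (Q : ℕ)
    (hκ : ∀ w j, κ w j = sub (h w j) j)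
    (hκ' : ∀ w j, κ' w j = digit (h w j) * Q + κ w j)
    (hQ : ∀ w, ∀ j ∈ J w, κ w j < Q) (hinj : ∀ w, Set.InjOn (κ' w) (J w))
    (hmono : ∀ w, ∀ y ∈ J w, ∀ y' ∈ J w, loc w y < loc w y' → κ w y < κ w y')
    (hdig : ∀ x, digit x < b) (hloc : ∀ w, ∀ j ∈ J w, loc w j < M)
    (hcap : ∀ w i, ((J w).filter fun j => loc w j = i).card ≤ 2 * B)
    (hB : 0 < B) (hMB : ∀ w, (J w).card ≤ M * B)
    (hV : 2 < V) (hbV : b ≤ V) (hJV : ∀ w, (J w).card < V)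
    (hfit : ∀ w, ∀ j ∈ J w, h w j < V ∧ j < V)
    (hb : 0 < b) (hM : M ≤ b ^ D) (hS : 2 * B + b + b * b ≤ S) :
    Steps (2 + D * 2 + 1 + (2 + D * 2) + 1) S V
      (fun w (i : Fin M) => (place (J w) (h w) (loc w) i, 0, 0))
      (fun w (i : Fin M) => (place (J w) (h w) (fun j => rank (J w) (κ' w) j / B) i, 0, 0)) := by
  classical
  let A : Ω → Fin M → Multiset (ℕ × ℕ) := fun w i => place (J w) (h w) (loc w) i
  let cnt : Ω → Fin M → ℕ → ℕ := fun w i u =>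
    ((J w).filter fun y => loc w y = i ∧ digit (h w y) = u).card
  have hcnt : ∀ w w' i, A w i = A w' i → ∀ u, cnt w i u = cnt w' i u := by
    intro w w' i hA u
    have h1 := filter_eq_of_place_eq hA
    simp only [cnt, ← Finset.filter_filter, ← h1]
    congr 1
    exact Finset.filter_congr fun y hy => by rw [height_eq_of_place_eq hA hy]
  let pre : Ω → Fin M → ℕ → ℕ := fun w i u => ∑ k with k < i, cnt w k u
  let suf : Ω → Fin M → ℕ → ℕ := fun w i u => ∑ k with i < k, cnt w k u
  have hsum : ∀ w u (t : Finset (Fin M)), ∑ k ∈ t, cnt w k u < V := by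
    intro w u t
    refine lt_of_le_of_lt ?_ (hJV w)
    calc ∑ k ∈ t, cnt w k u ≤ ∑ k, cnt w k u :=
          Finset.sum_le_sum_of_subset (Finset.subset_univ t)
      _ = ((J w).filter fun y => digit (h w y) = u).card :=
          sum_card_filter (hloc w) fun y => digit (h w y) = u
      _ ≤ _ := Finset.card_filter_le _ _
  have hAc : ∀ w i, (A w i).card ≤ 2 * B := fun w i => by
    rw [card_place]; exact hcap w i
  have hAV : ∀ w i, ∀ x ∈ A w i, x.1 < V ∧ x.2 < V := fun w i x hx => by
    obtain ⟨h1, -, h3⟩ := mem_place.1 hx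
    rw [h3]; exact hfit w _ h1
  have htab : ∀ (f : Ω → Fin M → ℕ → ℕ), (∀ w i v, f w i v < V) → ∀ w i,
      ∀ x ∈ table b (f w i), x.1 < V ∧ x.2 < V := fun f hf w i x hx => by
    obtain ⟨h1, h2⟩ := mem_table.1 hx
    exact ⟨h1.trans_le hbV, h2 ▸ hf w i _⟩
  have hpre := htab pre fun w i v => hsum w v _
  have hsuf := htab suf fun w i v => hsum w v _
  have s₁ : Steps (2 + D * 2) S V (fun w i => (A w i, 0, 0))
      (fun w i => (A w i, 0, table b (pre w i))) :=
    Steps.scan (S₀ := 2 * B) (Equiv.refl _) Multiset.sum Multiset.sum_singleton sum_bind_eq A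
      (fun _ _ => 0) cnt (fun w w' i h1 _ u _ => hcnt w w' i h1 u) hV hbV hb (by omega) hM
      (fun w i => ⟨by simpa [Registers.size] using hAc w i, hAV w i, by simp, by simp⟩)
      (fun w v _ t => hsum w v t)
  -- The prefix table is moved to the second register because the next scan writes its result into
  -- the third one.
  have s₂ : Steps 1 S V (fun w i => (A w i, 0, table b (pre w i)))
      (fun w i => (A w i, table b (pre w i), 0)) := by
    refine Steps.of_local hV
      (fun w i => ⟨?_, hAV w i, by simp, hpre w i⟩)
      (fun w i => ⟨?_, hAV w i, hpre w i, by simp⟩) (fun w w' i hi => ?_)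
    · have := hAc w i
      simp only [Registers.size, card_table, Multiset.card_zero]
      omega
    · have := hAc w i
      simp only [Registers.size, card_table, Multiset.card_zero]
      omega
    · simp only [Prod.mk.injEq] at hi ⊢
      exact ⟨hi.1, hi.2.2, trivial⟩
  have s₃ : Steps (2 + D * 2) S V (fun w i => (A w i, table b (pre w i), 0))
      (fun w i => (A w i, table b (pre w i), table b (suf w i))) := by
    -- Suffix sums are prefix sums along the reversed order of the machines.
    have := Steps.scan (S := S) (S₀ := 2 * B + b) (Fin.revPerm) Multiset.sum
      Multiset.sum_singleton sum_bind_eq A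
      (fun w i => table b (pre w i)) cnt (fun w w' i h1 _ u _ => hcnt w w' i h1 u) hV hbV hb hS hM
      (fun w i => ⟨by have := hAc w i; simp [Registers.size, card_table]; omega,
        hAV w i, hpre w i, by simp⟩)
      (fun w v _ t => hsum w v t)
    have hrev : ∀ j : Fin M, (Finset.univ.filter fun i => Fin.revPerm i < Fin.revPerm j) =
        Finset.univ.filter fun i => j < i := fun j => by ext; simp
    simp only [hrev] at this
    exact this
  -- The global rank in terms of data that machine `i` holds, so that the destination of an item is
  -- known to its sender.
  have hrank : ∀ w (i : Fin M), ∀ j ∈ (J w).filter fun j => loc w j = i, rank (J w) (κ' w) j =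
      (∑ u ∈ Finset.range (digit (h w j)), (pre w i u + cnt w i u + suf w i u)) +
      pre w i (digit (h w j)) +
      (((J w).filter fun j => loc w j = i).filter fun y =>
        digit (h w y) = digit (h w j) ∧ sub (h w y) y < sub (h w j) j).card := by
    intro w i j hj
    obtain ⟨hj, hji⟩ := Finset.mem_filter.1 hj
    rw [rank_refine (κ := κ w) (v := fun y => digit (h w y)) (loc := loc w) hj (hQ w) (hκ' w)
      (hmono w), hji, card_filter_lt_eq_sum (hloc w) (fun y => digit (h w y)),
      Finset.sum_congr rfl fun u _ =>
        card_filter_eq_sum_univ (hloc w) (fun y => digit (h w y)) u i, Finset.filter_filter]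
    simp only [hκ]
    rfl
  let loc' : Ω → ℕ → ℕ := fun w j => rank (J w) (κ' w) j / B
  have hloc' : ∀ w, ∀ j ∈ J w, loc' w j < M := fun w j hj =>
    (Nat.div_lt_iff_lt_mul hB).2 ((rank_lt_card hj).trans_le (hMB w))
  have s₄ : Steps 1 S V (fun w i => (A w i, table b (pre w i), table b (suf w i)))
      (fun w i => (place (J w) (h w) (loc' w) i, 0, 0)) := by
    refine Steps.of_messages (fun w i k => (((J w).filter fun j => loc w j = i ∧ loc' w j = k).val.map
      fun j => (h w j, j), 0, 0)) hV
      (fun w i => ⟨?_, hAV w i, hpre w i, hsuf w i⟩)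
      (fun w i => ⟨?_, fun x hx => ?_, by simp, by simp⟩) (fun w w' i hi => ?_) (fun w k => ?_)
      (fun w i => ?_)
    · have := hAc w i
      have := Nat.le_mul_of_pos_left b hb
      simp only [Registers.size, card_table]
      omega
    · have : (place (J w) (h w) (loc' w) i).card ≤ B := by
        rw [card_place]; exact card_filter_rank_div (hinj w) hB i
      simp only [Registers.size, Multiset.card_zero]
      omega
    · obtain ⟨h1, -, h3⟩ := mem_place.1 hx
      rw [h3]; exact hfit w _ h1
    · simp only [Prod.mk.injEq] at hi
      obtain ⟨h1, h2, h3⟩ := hi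
      have hF := filter_eq_of_place_eq h1
      have hh := fun j hj => height_eq_of_place_eq h1 (j := j) hj
      have hp := fun u hu => eq_of_table_eq h2 (v := u) hu
      have hs := fun u hu => eq_of_table_eq h3 (v := u) hu
      have hl : ∀ j ∈ (J w).filter fun j => loc w j = i, loc' w j = loc' w' j := by
        intro j hj
        simp only [loc']
        congr 1
        rw [hrank w i j hj, hrank w' i j (hF ▸ hj), ← hF, ← hh j hj]
        congr 1
        · congr 1
          · refine Finset.sum_congr rfl fun u hu => ?_
            have hu := (Finset.mem_range.1 hu).trans (hdig _)
            rw [hp u hu, hs u hu, hcnt w w' i h1]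
          · exact hp _ (hdig _)
        · congr 1
          exact Finset.filter_congr fun y hy => by rw [hh y hy]
      funext k
      congr 1
      rw [← Finset.filter_filter, ← Finset.filter_filter, ← hF,
        Finset.filter_congr fun j hj => by rw [hl j hj]]
      exact Multiset.map_congr rfl fun j hj => by
        rw [hh j (Finset.filter_subset _ _ hj)]
    · refine Prod.ext ?_ (Prod.ext ?_ ?_)
      · simp only [Prod.fst_sum]
        exact sum_filter_map (hloc w) (fun j => loc' w j = k) _
      · simp [Prod.snd_sum]
      · simp [Prod.snd_sum]
    · have := sum_card_filter (hloc' w) fun j => loc w j = i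
      have hc := hcap w i
      simp only [Registers.size, Multiset.card_map, Multiset.card_zero, add_zero, Finset.card_val]
      simp only [and_comm (a := loc w _ = _)]
      omega
  exact ((s₁.trans s₂).trans s₃).trans s₄

end MPCAlgorithm

/-! ### Heights in a properly nested string -/

/-- The number of opening minus the number of closing tags among the first `q` tokens. -/
def height (Z : List Token) (q : ℕ) : ℤ :=
  ((Z.take q).map fun x => if x.isOpen then (1 : ℤ) else -1).sum

/-- The positions of the opening tags, when the string starts at position `p`. -/
def openPositions (p : ℕ) : List Token → List ℕ
  | [] => []
  | x :: Z => (if x.isOpen then [p] else []) ++ openPositions (p + 1) Z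

/-- The set of the positions of the opening tags. -/
def openers (Z : List Token) : Finset ℕ := (openPositions 0 Z).toFinset

/-- The depth of the node whose opening tag is at position `p`, if `O` is the set of the positions
of all opening tags. -/
def depth (O : Finset ℕ) (p : ℕ) : ℕ := 2 * (O.filter fun q => q < p).card - p

theorem height_zero (Z : List Token) : height Z 0 = 0 := by simp [height]

theorem height_cons (x : Token) (Z : List Token) (q : ℕ) :
    height (x :: Z) (q + 1) = (if x.isOpen then 1 else -1) + height Z q := by simp [height]

theorem height_append_left {Z Z' : List Token} {q : ℕ} (hq : q ≤ Z.length) :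
    height (Z ++ Z') q = height Z q := by
  simp [height, List.take_append_of_le_length hq]

theorem height_append_right (Z Z' : List Token) (q : ℕ) :
    height (Z ++ Z') (Z.length + q) = height Z Z.length + height Z' q := by
  simp only [height, List.take_append, List.take_length, Nat.add_sub_cancel_left,
    List.take_of_length_le (Nat.le_add_right _ q), List.map_append, List.sum_append]

theorem openPositions_append (p : ℕ) (Z Z' : List Token) :
    openPositions p (Z ++ Z') = openPositions p Z ++ openPositions (p + Z.length) Z' := by
  induction Z generalizing p with
  | nil => simp [openPositions]
  | cons x Z ih =>
    rw [List.cons_append, openPositions, ih, openPositions, List.append_assoc, List.length_cons,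
      add_right_comm, add_assoc]

theorem mem_openPositions {p : ℕ} {Z : List Token} {q : ℕ} :
    q ∈ openPositions p Z ↔ ∃ k x, q = p + k ∧ Z[k]? = some x ∧ x.isOpen = true := by
  induction Z generalizing p with
  | nil => simp [openPositions]
  | cons y Z ih =>
    rw [openPositions, List.mem_append, ih]
    constructor
    · rintro (h | ⟨k, x, rfl, h⟩)
      · split_ifs at h with hy
        · exact ⟨0, y, by simpa using h, by simp, hy⟩
        · simp at h
      · exact ⟨k + 1, x, by omega, by simpa using h⟩
    · rintro ⟨k, x, rfl, h⟩
      cases k with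
      | zero =>
        simp only [List.getElem?_cons_zero, Option.some.injEq] at h
        obtain ⟨rfl, h⟩ := h
        exact Or.inl (by simp [h])
      | succ k => exact Or.inr ⟨k, x, by omega, by simpa using h⟩

theorem nodup_openPositions (p : ℕ) (Z : List Token) : (openPositions p Z).Nodup := by
  induction Z generalizing p with
  | nil => simp [openPositions]
  | cons x Z ih =>
    rw [openPositions, List.nodup_append]
    refine ⟨by split_ifs <;> simp, ih _, ?_⟩
    rintro a ha b hb rfl
    obtain ⟨k, y, rfl, -⟩ := mem_openPositions.1 hb
    split_ifs at ha
    · have := List.mem_singleton.1 ha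
      omega
    · simp at ha

theorem mem_openers {Z : List Token} {q : ℕ} :
    q ∈ openers Z ↔ ∃ x, Z[q]? = some x ∧ x.isOpen = true := by
  simp [openers, mem_openPositions]

/-- If `k` of the first `q` tokens are opening, then `q - k` are closing. -/
theorem height_eq (Z : List Token) : ∀ q ≤ Z.length,
    height Z q = 2 * ((openers Z).filter fun k => k < q).card - q := by
  intro q hq
  induction q with
  | zero => simp [height_zero]
  | succ q ih =>
    have ih := ih (by omega)
    have hlt : q < Z.length := by omega
    have h1 : height Z (q + 1) = height Z q + if Z[q].isOpen then 1 else -1 := by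
      rw [height, List.take_succ_eq_append_getElem hlt, List.map_append, List.sum_append, height]
      simp
    have h2 : ((openers Z).filter fun k => k < q + 1) =
        if Z[q].isOpen then insert q ((openers Z).filter fun k => k < q)
          else (openers Z).filter fun k => k < q := by
      have hq : q ∈ openers Z ↔ Z[q].isOpen = true := by
        rw [mem_openers]; simp [hlt]
      ext k
      split_ifs with h
      · simp only [Finset.mem_filter, Finset.mem_insert]
        constructor
        · rintro ⟨h3, h4⟩
          rcases Nat.lt_succ_iff_lt_or_eq.1 h4 with h5 | h5
          · exact Or.inr ⟨h3, h5⟩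
          · exact Or.inl h5
        · rintro (rfl | ⟨h3, h4⟩)
          · exact ⟨hq.2 h, by omega⟩
          · exact ⟨h3, by omega⟩
      · simp only [Finset.mem_filter]
        constructor
        · rintro ⟨h3, h4⟩
          rcases Nat.lt_succ_iff_lt_or_eq.1 h4 with h5 | rfl
          · exact ⟨h3, h5⟩
          · exact absurd (hq.1 h3) h
        · rintro ⟨h3, h4⟩
          exact ⟨h3, by omega⟩
    rw [h1, h2, ih]
    split_ifs with h
    · rw [Finset.card_insert_of_notMem (by simp)]
      push_cast; ring
    · push_cast; ring

-- Heights and parents in the string of a tree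

namespace TagTree

mutual

theorem height_tagString : ∀ T : TagTree, height T.tagString T.tagString.length = 0 ∧
    ∀ q ≤ T.tagString.length, 0 ≤ height T.tagString q
  | node a cs => by
    obtain ⟨h1, h2⟩ := height_forestString cs
    have e : tagString (node a cs) = ⟨true, a⟩ :: (forestString cs ++ [⟨false, a⟩]) := by
      simp [tagString]
    have h3 : height (forestString cs ++ [⟨false, a⟩]) ((forestString cs).length + 1) = -1 := by
      rw [height_append_right, h1]; simp [height]
    rw [e]
    refine ⟨by simp [height_cons, h3], fun q hq => ?_⟩
    cases q with
    | zero => simp [height_zero]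
    | succ q =>
      rw [height_cons]
      simp only [List.length_cons, List.length_append, List.length_nil] at hq
      rcases Nat.lt_or_ge (forestString cs).length q with h | h
      · obtain rfl : q = (forestString cs).length + 1 := by omega
        rw [h3]; simp
      · rw [height_append_left h]
        have := h2 q h
        simp; omega

theorem height_forestString : ∀ cs : List TagTree,
    height (forestString cs) (forestString cs).length = 0 ∧
      ∀ q ≤ (forestString cs).length, 0 ≤ height (forestString cs) q
  | [] => by simp [forestString, height]
  | T :: Ts => by
    obtain ⟨h1, h2⟩ := height_tagString T
    obtain ⟨h3, h4⟩ := height_forestString Ts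
    rw [forestString]
    refine ⟨by rw [List.length_append, height_append_right, h1, h3]; rfl, fun q hq => ?_⟩
    rcases Nat.le_total q T.tagString.length with h | h
    · rw [height_append_left h]; exact h2 q h
    · obtain ⟨k, rfl⟩ := Nat.exists_eq_add_of_le h
      rw [height_append_right, h1, zero_add]
      exact h4 k (by rw [List.length_append] at hq; omega)

end

theorem tagString_eq_cons (T : TagTree) : ∃ a s, T.tagString = ⟨true, a⟩ :: s := by
  obtain ⟨a, cs⟩ := T
  exact ⟨a, forestString cs ++ [⟨false, a⟩], by simp [tagString]⟩

mutual

/-- Opening tags and edges are both listed in preorder, and every node except the root is the child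
of exactly one edge. -/
theorem openPositions_tagString : ∀ (p : ℕ) (T : TagTree),
    openPositions p T.tagString = p :: (edgesFrom p T).map Prod.fst
  | p, node a cs => by
    simp [tagString, edgesFrom, openPositions, openPositions_append,
      openPositions_forestString p (p + 1) cs]

theorem openPositions_forestString : ∀ (r p : ℕ) (cs : List TagTree),
    openPositions p (forestString cs) = (forestEdges r p cs).map Prod.fst
  | _, _, [] => by simp [forestString, forestEdges, openPositions]
  | r, p, T :: Ts => by
    simp [forestString, forestEdges, openPositions_append, openPositions_tagString p T,
      openPositions_forestString r _ Ts]

end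

/-- In the string `Z`, the node at `r` is the parent of the node at `c`. -/
structure IsParent (Z : List Token) (r c : ℕ) : Prop where
  mem : r ∈ openers Z
  lt : r < c
  height_eq : height Z c = height Z r + 1
  height_lt : ∀ q, r < q → q < c → height Z r < height Z q

theorem mem_openers_append {u s v : List Token} {a : ℕ} :
    u.length ∈ openers (u ++ (⟨true, a⟩ :: s) ++ v) := by
  rw [mem_openers]
  exact ⟨⟨true, a⟩, by simp, rfl⟩

mutual

theorem isParent_of_mem_edgesFrom : ∀ (T : TagTree) (u v : List Token) (p : ℕ) (Z : List Token),
    p = u.length → Z = u ++ T.tagString ++ v → ∀ e ∈ edgesFrom p T, IsParent Z e.2 e.1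
  | node a cs, u, v, p, Z, hp, hZ, e, he => by
    have hZ' : Z = (u ++ [⟨true, a⟩]) ++ forestString cs ++ ([⟨false, a⟩] ++ v) := by
      rw [hZ]; simp [tagString]
    refine isParent_of_mem_forestEdges cs (u ++ [⟨true, a⟩]) ([⟨false, a⟩] ++ v) p (p + 1) Z
      (by simp [hp]) hZ' ?_ (by omega) ?_ (fun q h1 h2 => by omega) e (by simpa [edgesFrom] using he)
    · have : Z = u ++ (⟨true, a⟩ :: (forestString cs ++ [⟨false, a⟩])) ++ v := by
        rw [hZ]; simp [tagString]
      rw [this, hp]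
      exact mem_openers_append
    · have : Z = u ++ (⟨true, a⟩ :: (forestString cs ++ ([⟨false, a⟩] ++ v))) := by
        rw [hZ']; simp
      have h1 := height_append_right u (⟨true, a⟩ :: (forestString cs ++ ([⟨false, a⟩] ++ v))) 0
      rw [add_zero, height_zero, add_zero] at h1
      rw [this, hp, height_append_right, height_cons, height_zero, h1]
      simp

/-- The context `u`, `v` allows heights to be measured in the whole string. The last hypotheses are
the invariant along the children of `r`: the next child starts one above `r`, and the height has
stayed above that of `r` in between. A child preserves it, since its string ends at its starting
height and never goes below. -/
theorem isParent_of_mem_forestEdges : ∀ (cs : List TagTree) (u v : List Token) (r p : ℕ)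
    (Z : List Token), p = u.length → Z = u ++ forestString cs ++ v → r ∈ openers Z → r < p →
      height Z p = height Z r + 1 → (∀ q, r < q → q < p → height Z r < height Z q) →
        ∀ e ∈ forestEdges r p cs, IsParent Z e.2 e.1
  | [], _, _, _, _, _, _, _, _, _, _, _, e, he => by simp [forestEdges] at he
  | T :: Ts, u, v, r, p, Z, hp, hZ, hr, hrp, hh, hlt, e, he => by
    have hZ₁ : Z = u ++ T.tagString ++ (forestString Ts ++ v) := by rw [hZ]; simp [forestString]
    have hZ₂ : Z = (u ++ T.tagString) ++ forestString Ts ++ v := by rw [hZ]; simp [forestString]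
    have hin : ∀ k ≤ T.tagString.length, height Z (p + k) = height Z p + height T.tagString k := by
      intro k hk
      have h0 := height_append_right u (T.tagString ++ (forestString Ts ++ v)) 0
      rw [add_zero, height_zero, add_zero] at h0
      rw [hZ₁, List.append_assoc, hp, h0, height_append_right, height_append_left hk]
    obtain ⟨h1, h2⟩ := height_tagString T
    rw [forestEdges, List.mem_cons, List.mem_append] at he
    rcases he with rfl | he | he
    · exact ⟨hr, hrp, hh, hlt⟩
    · exact isParent_of_mem_edgesFrom T u _ p Z hp hZ₁ e he
    · refine isParent_of_mem_forestEdges Ts (u ++ T.tagString) v r _ Z (by simp [hp]) hZ₂ hr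
        (by omega) (by rw [hin _ le_rfl, h1, hh, add_zero]) (fun q hq1 hq2 => ?_) e he
      rcases Nat.lt_or_ge q p with h | h
      · exact hlt q hq1 h
      · obtain ⟨k, rfl⟩ := Nat.exists_eq_add_of_le h
        have := h2 k (by omega)
        rw [hin k (by omega)]
        omega

end

/-- Heights in a nested string are nonnegative, so the truncated subtraction in `depth` loses
nothing. -/
theorem depth_openers_tagString (T : TagTree) {q : ℕ} (hq : q ≤ T.tagString.length) :
    (depth (openers T.tagString) q : ℤ) = height T.tagString q := by
  have h1 := (height_tagString T).2 q hq
  have h2 := height_eq T.tagString q hq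
  unfold depth
  omega

theorem lt_length_of_mem_openers {Z : List Token} {q : ℕ} (h : q ∈ openers Z) : q < Z.length := by
  obtain ⟨x, h1, -⟩ := mem_openers.1 h
  exact (List.getElem?_eq_some_iff.1 h1).1

/-- The final height is `0`. Hence there are at most `n` items, although each node gives up to two.
-/
theorem two_mul_card_openers (T : TagTree) :
    2 * (openers T.tagString).card = T.tagString.length := by
  have h1 := (height_tagString T).1
  have h2 := height_eq T.tagString _ le_rfl
  rw [Finset.filter_true_of_mem fun q hq => lt_length_of_mem_openers hq] at h2
  omega

theorem map_fst_edges (T : TagTree) :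
    (T.edges : Multiset (ℕ × ℕ)).map Prod.fst = ((openers T.tagString).erase 0).val := by
  have h1 := openPositions_tagString 0 T
  have h2 : (openers T.tagString).val = ((0 :: (edgesFrom 0 T).map Prod.fst : List ℕ) : Multiset ℕ) := by
    rw [openers, List.toFinset_val, (nodup_openPositions _ _).dedup, h1]
  rw [Finset.erase_val, h2]
  simp [edges]

theorem parent_spec (T : TagTree) {e : ℕ × ℕ} (he : e ∈ T.edges) :
    e.2 ∈ openers T.tagString ∧ e.2 < e.1 ∧
      depth (openers T.tagString) e.1 = depth (openers T.tagString) e.2 + 1 ∧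
      ∀ q ∈ openers T.tagString, e.2 < q → q < e.1 →
        depth (openers T.tagString) e.2 < depth (openers T.tagString) q := by
  have hp := isParent_of_mem_edgesFrom T [] [] 0 T.tagString rfl (by simp) e he
  have hc : e.1 ∈ (openers T.tagString).erase 0 := by
    rw [← Finset.mem_val, ← map_fst_edges]
    exact Multiset.mem_map_of_mem _ he
  have hlt : ∀ q ∈ openers T.tagString,
      (depth (openers T.tagString) q : ℤ) = height T.tagString q := fun q hq =>
    depth_openers_tagString T (lt_length_of_mem_openers hq).le
  have h1 := hlt _ (Finset.mem_of_mem_erase hc)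
  have h2 := hlt _ hp.mem
  have h3 := hp.height_eq
  refine ⟨hp.mem, hp.lt, by omega, fun q hq hq1 hq2 => ?_⟩
  have h4 := hlt q hq
  have h5 := hp.height_lt q hq1 hq2
  omega

end TagTree

-- The first and the last round

namespace MPCAlgorithm

variable {M : ℕ} {Ω : Type*} {S V W : ℕ}

/-- A last round, in which every machine outputs a list of edges that depends on its registers. -/
theorem Realizes.output {X : Ω → Fin M → Registers} (E : Ω → Fin M → Multiset (ℕ × ℕ))
    (edges : Ω → List (ℕ × ℕ)) (hV : 2 < V) (hVW : V ^ 4 ≤ W) (hX : ∀ w i, (X w i).Fits S V)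
    (hE : ∀ w w' i, X w i = X w' i → E w i = E w' i) (hcard : ∀ w i, 2 * (E w i).card ≤ S)
    (hlt : ∀ w i, ∀ e ∈ E w i, e.1 < W ∧ e.2 < W)
    (hsum : ∀ w, ∑ i, E w i = (edges w : Multiset (ℕ × ℕ))) :
    Realizes 1 S W (Stores X) (fun w mem => HoldsEdges mem (edges w)) := by
  classical
  let flat : List (ℕ × ℕ) → List ℕ := fun l => l.flatMap fun e => [e.1, e.2]
  have length_flat : ∀ l, (flat l).length = 2 * l.length := fun l => by
    induction l with
    | nil => rfl
    | cons e l ih => simp [flat] at ih ⊢; omega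
  let dec : Fin M → List ℕ → Multiset (ℕ × ℕ) := fun i l =>
    if h : ∃ w, (l : Multiset ℕ) = (X w i).words then E h.choose i else 0
  have hdec : ∀ w init, Stores X w init → ∀ i, dec i (init i) = E w i := by
    intro w init h i
    have hex : ∃ w, (init i : Multiset ℕ) = (X w i).words := ⟨w, h i⟩
    simp only [dec, dif_pos hex]
    exact hE _ _ i (Registers.words_injective (hex.choose_spec.symm.trans (h i)))
  let send : Fin M → List ℕ → Fin M → List ℕ := fun i l j =>
    if i = j then flat (dec i l).toList else []
  have hrec : ∀ w init, Stores X w init → ∀ j,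
      ((List.finRange M).flatMap fun i => send i (init i) j) = flat (E w j).toList := by
    intro w init h j
    have : ∀ l : List (Fin M), l.Nodup → (l.flatMap fun i => send i (init i) j) =
        if j ∈ l then flat (E w j).toList else [] := by
      intro l hl
      induction l with
      | nil => simp
      | cons i l ih =>
        obtain ⟨h1, h2⟩ := List.nodup_cons.1 hl
        rw [List.flatMap_cons, ih h2]
        by_cases hij : i = j
        · subst hij
          simp [send, h1, hdec w init h]
        · simp [send, hij, Ne.symm hij]
    rw [this _ (List.nodup_finRange M), if_pos (List.mem_finRange j)]
  refine Realizes.of_send send (fun w init h i => ?_) (fun w init h i => ?_)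
    (fun w init h j => ?_) (fun w init h => ⟨fun i => (E w i).toList, fun i => hrec w init h i, ?_⟩)
  · obtain ⟨h1, h2⟩ := h.limits hV hX i
    exact ⟨h1, fun x hx => (h2 x hx).trans_le hVW⟩
  · have : ∀ j, (send i (init i) j).length = if i = j then 2 * (E w i).card else 0 := fun j => by
      simp only [send, hdec w init h]
      split_ifs
      · rw [length_flat, Multiset.length_toList]
      · rfl
    simpa [this] using hcard w i
  · rw [hrec w init h]
    refine ⟨by rw [length_flat, Multiset.length_toList]; exact hcard w j, fun x hx => ?_⟩
    obtain ⟨e, he, hx⟩ := List.mem_flatMap.1 hx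
    have := hlt w j e (Multiset.mem_toList.1 he)
    simp only [List.mem_cons, List.not_mem_nil, or_false] at hx
    rcases hx with rfl | rfl
    · exact this.1
    · exact this.2
  · rw [← Multiset.coe_eq_coe, coe_flatMap_finRange, ← hsum]
    simp

/-- A first round, in which every machine replaces its block of words by records for the positions
of the odd words. -/
theorem Realizes.input {B n : ℕ} (A : Ω → List ℕ) (O : Ω → Finset ℕ) (hB : 0 < B) (hBS : B ≤ S)
    (hO : ∀ w p, p ∈ O w ↔ ∃ x, (A w)[p]? = some x ∧ x % 2 = 1)
    (hA : ∀ w, ∀ x ∈ A w, x < W) (hn : ∀ w, (A w).length = n) (hnV : n ≤ V) (hV : 2 < V)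
    (hVW : V ^ 4 ≤ W) :
    Realizes 1 S W
      (fun w mem => mem = fun i : Fin M => ((A w).drop (i * B)).take B)
      (Stores fun w (i : Fin M) => (place (O w) (fun _ => 0) (fun p => p / B) i, 0, 0)) := by
  classical
  let X : Ω → Fin M → Registers := fun w i => (place (O w) (fun _ => 0) (fun p => p / B) i, 0, 0)
  -- The default `0` of `getD` is even, so places beyond the end of an incomplete block yield no
  -- record.
  let parse : Fin M → List ℕ → List ℕ := fun i l =>
    ((List.range B).filter fun k => l.getD k 0 % 2 = 1).map
      fun k => Registers.encode 0 (0, i * B + k)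
  let send : Fin M → List ℕ → Fin M → List ℕ := fun i l j => if i = j then parse i l else []
  have hlen : ∀ i l, (parse i l).length ≤ B := fun i l => by
    simp only [parse, List.length_map]
    exact (List.length_filter_le _ _).trans (by simp)
  have hparse : ∀ w (i : Fin M),
      (parse i (((A w).drop (i * B)).take B) : Multiset ℕ) = (X w i).words := by
    intro w i
    have h1 : (((List.range B).filter fun k => (((A w).drop (i * B)).take B).getD k 0 % 2 = 1).map
        fun k => i * B + k : List ℕ) = ((O w).filter fun p => p / B = i).val := by
      refine (Multiset.Nodup.ext ?_ (Finset.nodup _)).2 fun p => ?_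
      · rw [Multiset.coe_nodup]
        exact (List.nodup_range.filter _).map fun a b h => Nat.add_left_cancel h
      · simp only [Multiset.mem_coe, List.mem_map, List.mem_filter, List.mem_range,
          decide_eq_true_eq, Finset.mem_val, Finset.mem_filter, hO]
        have key : ∀ k < B, (((A w).drop (i * B)).take B).getD k 0 % 2 = 1 ↔
            ∃ x, (A w)[i * B + k]? = some x ∧ x % 2 = 1 := by
          intro k hk
          rw [List.getD_eq_getElem?_getD, List.getElem?_take_of_lt hk, List.getElem?_drop]
          cases (A w)[i * B + k]? <;> simp
        constructor
        · rintro ⟨k, ⟨hk, h⟩, rfl⟩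
          refine ⟨(key k hk).1 h, ?_⟩
          rw [mul_comm, Nat.mul_add_div hB, Nat.div_eq_of_lt hk, add_zero]
        · rintro ⟨h, hp⟩
          have h2 := Nat.div_add_mod' p B
          rw [hp] at h2
          have h3 := Nat.mod_lt p hB
          exact ⟨p % B, ⟨h3, (key _ h3).2 (by rwa [h2])⟩, h2⟩
    have h2 := congrArg (Multiset.map fun p => Registers.encode 0 (0, p)) h1
    rw [Multiset.map_coe, List.map_map] at h2
    simpa [X, Registers.words, place, Multiset.map_map, Function.comp_def, parse] using h2
  have hst : ∀ w init, (init = fun i : Fin M => ((A w).drop (i * B)).take B) →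
      Stores X w (fun j => (List.finRange M).flatMap fun i => send i (init i) j) := by
    rintro w _ rfl j
    rw [coe_flatMap_finRange, Finset.sum_eq_single j]
    · simpa [send] using hparse w j
    · intro i _ hi
      simp [send, hi]
    · simp
  have hX : ∀ w i, (X w i).Fits S V := by
    intro w i
    refine ⟨?_, fun x hx => ?_, by simp [X], by simp [X]⟩
    · rw [← Registers.card_words, ← hparse w i, Multiset.coe_card]
      exact (hlen _ _).trans hBS
    · obtain ⟨h1, -, h3⟩ := mem_place.1 hx
      obtain ⟨x', h4, -⟩ := (hO w _).1 h1
      have := (List.getElem?_eq_some_iff.1 h4).1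
      rw [hn] at this
      exact ⟨by rw [h3]; omega, by omega⟩
  refine Realizes.of_send send ?_ ?_
    (fun w init h j => ?_) hst
  · rintro w _ rfl i
    refine ⟨by simp; omega, fun x hx => hA w x ?_⟩
    exact List.mem_of_mem_drop (List.mem_of_mem_take hx)
  · intro w init h i
    have : ∀ j, (send i (init i) j).length = if i = j then (parse i (init i)).length else 0 :=
      fun j => by simp only [send]; split_ifs <;> rfl
    simp only [this, Finset.sum_ite_eq, Finset.mem_univ, if_true]
    exact (hlen _ _).trans hBS
  · obtain ⟨h1, h2⟩ := (hst w init h).limits hV hX j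
    exact ⟨h1, fun x hx => (h2 x hx).trans_le hVW⟩

end MPCAlgorithm

/-! ### Nodes in the roles of parents and of children -/

/-- A node `p` occurs as the item `2 * p + 1` in the role of a parent, and, unless it is the root,
as the item `2 * p` in the role of a child. -/
def items (O : Finset ℕ) : Finset ℕ := (O.image (2 * ·) ∪ O.image (2 * · + 1)).erase 0

/-- The depth of the node, or of its parent if the item is in the role of a child. -/
def level (O : Finset ℕ) (j : ℕ) : ℕ := depth O (j / 2) - (1 - j % 2)

/-- The key of an item after sorting by the last `k` digits of the level in base `b`. -/
def sortKey (n b k : ℕ) (O : Finset ℕ) (j : ℕ) : ℕ := level O j % b ^ k * (2 * n) + j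

theorem mem_items {O : Finset ℕ} {j : ℕ} : j ∈ items O ↔ j / 2 ∈ O ∧ j ≠ 0 := by
  simp only [items, Finset.mem_erase, Finset.mem_union, Finset.mem_image]
  constructor
  · rintro ⟨h, ⟨p, hp, rfl⟩ | ⟨p, hp, rfl⟩⟩
    · exact ⟨by rwa [show 2 * p / 2 = p by omega], h⟩
    · exact ⟨by rwa [show (2 * p + 1) / 2 = p by omega], h⟩
  · rintro ⟨hp, h⟩
    refine ⟨h, ?_⟩
    rcases Nat.mod_two_eq_zero_or_one j with hj | hj
    · exact Or.inl ⟨j / 2, hp, by omega⟩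
    · exact Or.inr ⟨j / 2, hp, by omega⟩

theorem card_items_le (O : Finset ℕ) : (items O).card ≤ 2 * O.card := by
  refine (Finset.card_erase_le).trans ((Finset.card_union_le _ _).trans ?_)
  have h1 := Finset.card_image_le (s := O) (f := (2 * ·))
  have h2 := Finset.card_image_le (s := O) (f := (2 * · + 1))
  omega

theorem depth_le (O : Finset ℕ) (p : ℕ) : depth O p ≤ p := by
  have : (O.filter fun q => q < p).card ≤ (Finset.range p).card :=
    Finset.card_le_card fun q hq => Finset.mem_range.2 (Finset.mem_filter.1 hq).2
  rw [Finset.card_range] at this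
  unfold depth
  omega

theorem level_lt {n : ℕ} {O : Finset ℕ} (hO : ∀ p ∈ O, p < n) {j : ℕ} (hj : j ∈ items O) :
    level O j < n := by
  have h1 := depth_le O (j / 2)
  have h2 := hO _ (mem_items.1 hj).1
  unfold level
  omega

theorem lt_of_mem_items {n : ℕ} {O : Finset ℕ} (hO : ∀ p ∈ O, p < n) {j : ℕ} (hj : j ∈ items O) :
    j < 2 * n := by
  have h2 := hO _ (mem_items.1 hj).1
  omega

/-- Items are below `2 * n`, so the key modulo `2 * n` recovers the item. -/
theorem sortKey_injOn {n : ℕ} (b k : ℕ) {O : Finset ℕ} (hO : ∀ p ∈ O, p < n) :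
    Set.InjOn (sortKey n b k O) (items O) := by
  intro j hj j' hj' h
  have h1 := lt_of_mem_items hO hj
  have h2 := lt_of_mem_items hO hj'
  have h3 := congrArg (· % (2 * n)) h
  simpa [sortKey, Nat.mul_add_mod_self_right, Nat.mod_eq_of_lt h1, Nat.mod_eq_of_lt h2] using h3

/-- The next digit becomes the most significant part of the key, as a pass of radix sort requires.
-/
theorem sortKey_succ (n b k : ℕ) (O : Finset ℕ) (j : ℕ) :
    sortKey n b (k + 1) O j = level O j / b ^ k % b * (b ^ k * (2 * n)) + sortKey n b k O j := by
  simp only [sortKey, Nat.mod_pow_succ]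
  ring

theorem sortKey_lt {n b k : ℕ} (hb : 0 < b) {O : Finset ℕ} (hO : ∀ p ∈ O, p < n) {j : ℕ}
    (hj : j ∈ items O) : sortKey n b k O j < b ^ k * (2 * n) := by
  have h1 := lt_of_mem_items hO hj
  have h2 := Nat.mul_le_mul_right (2 * n)
    (Nat.succ_le_of_lt (Nat.mod_lt (level O j) (Nat.pow_pos (n := k) hb)))
  rw [Nat.succ_mul] at h2
  unfold sortKey
  omega

theorem sortKey_eq {n b k : ℕ} (hn : n ≤ b ^ k) {O : Finset ℕ} (hO : ∀ p ∈ O, p < n) {j : ℕ}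
    (hj : j ∈ items O) : sortKey n b k O j = level O j * (2 * n) + j := by
  rw [sortKey, Nat.mod_eq_of_lt ((level_lt hO hj).trans_le hn)]

/-- The greatest key (plus one) of an item that precedes `j` and has the role of a parent. -/
def lastParentKey (n : ℕ) (O : Finset ℕ) (j : ℕ) : ℕ :=
  ((items O).filter fun y => y % 2 = 1 ∧
    level O y * (2 * n) + y < level O j * (2 * n) + j).sup fun y => level O y * (2 * n) + y + 1

/-- The node that is read off from `lastParentKey`. -/
def foundParent (n : ℕ) (O : Finset ℕ) (j : ℕ) : ℕ := (lastParentKey n O j - 1) % (2 * n) / 2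

/-- The child item of `c` and the parent item of `r` share the level `depth O r`. A parent item
before that child item has a smaller level, or the same level and a position before `c`; in the
second case the position is at most `r`, since all nodes strictly between `r` and `c` are deeper. -/
theorem foundParent_eq {n : ℕ} {O : Finset ℕ} (hO : ∀ p ∈ O, p < n) {r c : ℕ} (hr : r ∈ O)
    (hc : c < n) (hrc : r < c) (hd : depth O c = depth O r + 1)
    (hlt : ∀ q ∈ O, r < q → q < c → depth O r < depth O q) : foundParent n O (2 * c) = r := by
  have hlc : level O (2 * c) = depth O r := by
    have h1 : 2 * c / 2 = c := by omega
    have h2 : 2 * c % 2 = 0 := by omega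
    rw [level, h1, h2, hd]; rfl
  have hlo : ∀ q, level O (2 * q + 1) = depth O q := fun q => by
    have h1 : (2 * q + 1) / 2 = q := by omega
    have h2 : (2 * q + 1) % 2 = 1 := by omega
    rw [level, h1, h2]; rfl
  have key : lastParentKey n O (2 * c) = depth O r * (2 * n) + (2 * r + 1) + 1 := by
    refine le_antisymm (Finset.sup_le fun y hy => ?_) ?_
    · obtain ⟨hy, hodd, hyc⟩ := Finset.mem_filter.1 hy
      obtain ⟨q, rfl⟩ : ∃ q, y = 2 * q + 1 := ⟨y / 2, by omega⟩
      have hq : q ∈ O := by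
        have := (mem_items.1 hy).1
        rwa [show (2 * q + 1) / 2 = q by omega] at this
      have hqn := hO q hq
      rw [hlo, hlc] at hyc
      rw [hlo]
      rcases lt_trichotomy (depth O q) (depth O r) with h | h | h
      · have := Nat.mul_le_mul_right (2 * n) (Nat.succ_le_of_lt h)
        rw [Nat.succ_mul] at this
        omega
      · rw [h] at hyc ⊢
        have : q ≤ r := by
          by_contra hqr
          exact (hlt q hq (by omega) (by omega)).ne' h
        omega
      · have := Nat.mul_le_mul_right (2 * n) (Nat.succ_le_of_lt h)
        rw [Nat.succ_mul] at this
        omega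
    · have hmem : 2 * r + 1 ∈ (items O).filter fun y => y % 2 = 1 ∧
          level O y * (2 * n) + y < level O (2 * c) * (2 * n) + 2 * c := by
        rw [Finset.mem_filter, mem_items, hlo, hlc]
        refine ⟨⟨by rwa [show (2 * r + 1) / 2 = r by omega], by omega⟩, by omega, by omega⟩
      have := Finset.le_sup (f := fun y => level O y * (2 * n) + y + 1) hmem
      rw [hlo] at this
      exact this
  have hrn := hO r hr
  -- Reduction modulo `2 * n` removes the level and leaves the item `2 * r + 1`.
  rw [foundParent, key, Nat.add_sub_cancel, Nat.mul_add_mod_self_right, Nat.mod_eq_of_lt (by omega)]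
  omega

-- Computing the depths, sorting the items, finding the parents

namespace MPCAlgorithm

variable {M : ℕ} {Ω : Type*} {S V W : ℕ}

/-- The position of an item after sorting by the last `k` digits of the levels. -/
def location (n b B : ℕ) (O : Finset ℕ) : ℕ → ℕ → ℕ
  | 0, j => j / 2 / B
  | k + 1, j => rank (items O) (sortKey n b (k + 1) O) j / B

/-- Locations are weakly monotone in the key. For `k = 0` the key is the item itself, so the initial
layout counts as sorted by zero digits. -/
theorem location_mono {n b B k : ℕ} {O : Finset ℕ} {y y' : ℕ}
    (h : location n b B O k y < location n b B O k y') :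
    sortKey n b k O y < sortKey n b k O y' := by
  cases k with
  | zero =>
    simp only [location] at h
    have h1 : y / 2 < y' / 2 := by
      by_contra h1
      exact h.not_ge (Nat.div_le_div_right (not_lt.1 h1))
    simp only [sortKey, pow_zero, Nat.mod_one, zero_mul, zero_add]
    omega
  | succ k =>
    simp only [location] at h
    by_contra h1
    refine h.not_ge (Nat.div_le_div_right (Finset.card_le_card fun z hz => ?_))
    rw [Finset.mem_filter] at hz ⊢
    exact ⟨hz.1, hz.2.trans_le (not_lt.1 h1)⟩

theorem card_filter_div_le (J : Finset ℕ) {B : ℕ} (hB : 0 < B) (i : ℕ) :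
    (J.filter fun p => p / B = i).card ≤ B := by
  calc (J.filter fun p => p / B = i).card ≤ (Finset.Ico (i * B) (i * B + B)).card := by
        refine Finset.card_le_card fun p hp => ?_
        have h1 := (Finset.mem_filter.1 hp).2
        have h2 := Nat.div_add_mod' p B
        have h3 := Nat.mod_lt p hB
        rw [h1] at h2
        rw [Finset.mem_Ico]
        omega
    _ = B := by simp

/-- The factor `2` is due to the initial layout, where both items of a node lie on the machine of
its opening tag. -/
theorem card_location_le {n b B : ℕ} (hB : 0 < B) {O : Finset ℕ} (hO : ∀ p ∈ O, p < n) (k i : ℕ) :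
    ((items O).filter fun j => location n b B O k j = i).card ≤ 2 * B := by
  cases k with
  | zero =>
    simp only [location, Nat.div_div_eq_div_mul]
    exact card_filter_div_le _ (by omega) i
  | succ k =>
    exact (card_filter_rank_div (sortKey_injOn b (k + 1) hO) hB i).trans (by omega)

theorem location_lt {n b B : ℕ} (hB : 0 < B) {O : Finset ℕ} (hO : ∀ p ∈ O, p < n)
    (hOn : 2 * O.card ≤ n) (hMB : n ≤ M * B) (k : ℕ) {j : ℕ} (hj : j ∈ items O) :
    location n b B O k j < M := by
  cases k with
  | zero => exact (Nat.div_lt_iff_lt_mul hB).2 ((hO _ (mem_items.1 hj).1).trans_le hMB)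
  | succ k =>
    exact (Nat.div_lt_iff_lt_mul hB).2
      ((rank_lt_card hj).trans_le (((card_items_le O).trans hOn).trans hMB))

/-- From the positions of the opening tags to items with their levels. -/
theorem Steps.makeItems {n b B D : ℕ} (O : Ω → Finset ℕ) (hO : ∀ w, ∀ p ∈ O w, p < n)
    (hOn : ∀ w, 2 * (O w).card ≤ n) (hn : 2 ≤ n) (hB : 0 < B) (hMB : n ≤ M * B)
    (hb : 0 < b) (hM : M ≤ b ^ D) (hV : 2 * n < V) (hS : 2 * B + b ≤ S) :
    Steps (2 + D * 2 + 1) S V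
      (fun w (i : Fin M) => (place (O w) (fun _ => 0) (fun p => p / B) i, 0, 0))
      (fun w (i : Fin M) => (place (items (O w)) (level (O w)) (location n b B (O w) 0) i, 0, 0)) := by
  classical
  let A : Ω → Fin M → Multiset (ℕ × ℕ) := fun w i => place (O w) (fun _ => 0) (fun p => p / B) i
  let cnt : Ω → Fin M → ℕ → ℕ := fun w i _ => ((O w).filter fun p => p / B = i).card
  have hlocO : ∀ w, ∀ p ∈ O w, p / B < M := fun w p hp =>
    (Nat.div_lt_iff_lt_mul hB).2 ((hO w p hp).trans_le hMB)
  have hsum : ∀ w u (t : Finset (Fin M)), ∑ k ∈ t, cnt w k u < V := by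
    intro w u t
    have := hOn w
    refine lt_of_le_of_lt ?_ (show (O w).card < V by omega)
    calc ∑ k ∈ t, cnt w k u ≤ ∑ k, cnt w k u :=
          Finset.sum_le_sum_of_subset (Finset.subset_univ t)
      _ = ((O w).filter fun _ => True).card := by
          simpa [cnt] using sum_card_filter (hlocO w) fun _ => True
      _ ≤ _ := Finset.card_filter_le _ _
  have hAV : ∀ w i, ∀ x ∈ A w i, x.1 < V ∧ x.2 < V := fun w i x hx => by
    obtain ⟨h1, -, h3⟩ := mem_place.1 hx
    have := hO w _ h1
    exact ⟨by rw [h3]; omega, by omega⟩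
  have hAc : ∀ w i, (A w i).card ≤ B := fun w i => by
    rw [card_place]; exact card_filter_div_le _ hB i
  have hcnt : ∀ w w' i, A w i = A w' i → ∀ u, cnt w i u = cnt w' i u := by
    intro w w' i hA u
    have h1 := filter_eq_of_place_eq hA
    simp only [cnt, h1]
  let pre : Ω → Fin M → ℕ → ℕ := fun w i u => ∑ k with k < i, cnt w k u
  have s₁ : Steps (2 + D * 2) S V (fun w i => (A w i, 0, 0))
      (fun w i => (A w i, 0, table 1 (pre w i))) :=
    Steps.scan (S₀ := B) (Equiv.refl _) Multiset.sum Multiset.sum_singleton sum_bind_eq A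
      (fun _ _ => 0) cnt (fun w w' i h1 _ u _ => hcnt w w' i h1 u) (by omega) (by omega) hb
      (by omega) hM
      (fun w i => ⟨by simpa [Registers.size] using hAc w i, hAV w i, by simp, by simp⟩)
      (fun w v _ t => hsum w v t)
  have hdepth : ∀ w (i : Fin M), ∀ p ∈ (O w).filter fun p => p / B = i, depth (O w) p =
      2 * (pre w i 0 + (((O w).filter fun p => p / B = i).filter fun q => q < p).card) - p := by
    intro w i p hp
    obtain ⟨hp, hpi⟩ := Finset.mem_filter.1 hp
    -- With a constant digit, `rank_refine` splits the count of earlier opening tags into those on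
    -- earlier machines and those on the same one.
    have := rank_refine (κ := fun q => q) (κ' := fun q => q) (v := fun _ => 0)
      (loc := fun q => q / B) (Q := n) hp (hO w) (by simp)
      (fun y _ y' _ h => by
        by_contra h1
        exact h.not_ge (Nat.div_le_div_right (not_lt.1 h1)))
    rw [hpi, card_filter_lt_eq_sum (hlocO w) (fun _ => 0)] at this
    simp only [Finset.range_zero, Finset.sum_empty, zero_add, true_and, and_true] at this
    rw [depth, Finset.filter_filter]
    change 2 * rank (O w) (fun q => q) p - p = _
    rw [this]
  refine s₁.trans (Steps.of_local (by omega) (fun w i => ⟨?_, hAV w i, by simp, fun x hx => ?_⟩)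
    (fun w i => ⟨?_, fun x hx => ?_, by simp, by simp⟩) fun w w' i hi => ?_)
  · have := hAc w i
    simp only [Registers.size, card_table, Multiset.card_zero]
    omega
  · obtain ⟨h1, h2⟩ := mem_table.1 hx
    exact ⟨by omega, h2 ▸ hsum w 0 _⟩
  · have := card_location_le (b := b) hB (hO w) 0 i
    simp only [Registers.size, card_place, Multiset.card_zero]
    omega
  · obtain ⟨h1, -, h3⟩ := mem_place.1 hx
    have h4 := level_lt (hO w) h1
    have h5 := lt_of_mem_items (hO w) h1
    exact ⟨by rw [h3]; omega, by omega⟩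
  · simp only [Prod.mk.injEq] at hi ⊢
    obtain ⟨h1, -, h3⟩ := hi
    have hF := filter_eq_of_place_eq h1
    have hp := eq_of_table_eq h3 zero_lt_one
    have hmem : ∀ w j, (j ∈ (items (O w)).filter fun j => location n b B (O w) 0 j = i) ↔
        j / 2 ∈ ((O w).filter fun p => p / B = i) ∧ j ≠ 0 := fun w j => by
      rw [Finset.mem_filter, Finset.mem_filter, mem_items]
      simp only [location]
      tauto
    refine ⟨place_congr ?_ fun j hj => ?_, trivial⟩
    · ext j
      rw [hmem, hmem, hF]
    · have hj := ((hmem w j).1 hj).1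
      rw [level, level, hdepth w i _ hj, hdepth w' i _ (hF ▸ hj), hF, hp]

/-- The items are sorted by their levels. -/
theorem Steps.sortItems {n b B D : ℕ} (O : Ω → Finset ℕ) (hO : ∀ w, ∀ p ∈ O w, p < n)
    (hOn : ∀ w, 2 * (O w).card ≤ n) (hn : 2 ≤ n) (hB : 0 < B) (hMB : n ≤ M * B)
    (hb : 0 < b) (hM : M ≤ b ^ D) (hbn : b ≤ n) (hV : 2 * n < V) (hS : 2 * B + b + b * b ≤ S) (k : ℕ) :
    Steps (k * (2 + D * 2 + 1 + (2 + D * 2) + 1)) S V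
      (fun w (i : Fin M) => (place (items (O w)) (level (O w)) (location n b B (O w) 0) i, 0, 0))
      (fun w (i : Fin M) =>
        (place (items (O w)) (level (O w)) (location n b B (O w) k) i, 0, 0)) := by
  refine Steps.iterate (fun k w (i : Fin M) =>
    (place (items (O w)) (level (O w)) (location n b B (O w) k) i, 0, 0)) (by omega)
    (fun w i => ⟨?_, fun x hx => ?_, by simp, by simp⟩) k fun l _ => ?_
  · have := card_location_le (b := b) hB (hO w) 0 i
    simp only [Registers.size, card_place, Multiset.card_zero]
    omega
  · obtain ⟨h1, -, h3⟩ := mem_place.1 hx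
    have h4 := level_lt (hO w) h1
    have h5 := lt_of_mem_items (hO w) h1
    exact ⟨by rw [h3]; omega, by omega⟩
  · have hJ : ∀ w, (items (O w)).card ≤ n := fun w => (card_items_le _).trans (hOn w)
    exact Steps.radixPass (fun w => items (O w)) (fun w => level (O w))
      (fun w => location n b B (O w) l) (fun x => x / b ^ l % b)
      (fun w => sortKey n b l (O w)) (fun w => sortKey n b (l + 1) (O w))
      (fun x j => x % b ^ l * (2 * n) + j) (b ^ l * (2 * n)) (fun w j => rfl)
      (fun w j => sortKey_succ n b l (O w) j) (fun w j hj => sortKey_lt hb (hO w) hj)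
      (fun w => sortKey_injOn b (l + 1) (hO w)) (fun w y _ y' _ h => location_mono h)
      (fun x => Nat.mod_lt _ hb) (fun w j hj => location_lt hB (hO w) (hOn w) hMB l hj)
      (fun w i => card_location_le hB (hO w) l i) hB (fun w => (hJ w).trans hMB) (by omega)
      (by omega) (fun w => (hJ w).trans_lt (by omega))
      (fun w j hj => ⟨(level_lt (hO w) hj).trans (by omega),
        (lt_of_mem_items (hO w) hj).trans hV⟩) hb hM hS

theorem multisetSup_bind (s : Multiset (Fin M)) (m : Fin M → Multiset ℕ) :
    (s.bind m).sup = (s.map fun i => (m i).sup).sup := by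
  induction s using Multiset.induction_on with
  | empty => simp
  | cons a s ih => simp [ih]

/-- The parents are found in the sorted sequence of items. -/
theorem Realizes.findParents {n b B D : ℕ} (O : Ω → Finset ℕ) (hO : ∀ w, ∀ p ∈ O w, p < n)
    (hOn : ∀ w, 2 * (O w).card ≤ n) (hn : 2 ≤ n) (hB : 0 < B) (hMB : n ≤ M * B)
    (hb : 0 < b) (hM : M ≤ b ^ D) (hnD : n ≤ b ^ D) (hV : 2 * n * n < V)
    (hVW : V ^ 4 ≤ W) (hS : 4 * B + b ≤ S) (edges : Ω → List (ℕ × ℕ))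
    (hedges : ∀ w, ((edges w : Multiset (ℕ × ℕ))) =
      ((items (O w)).filter fun j => j % 2 = 0).val.map fun j => (j / 2, foundParent n (O w) j)) :
    Realizes (2 + D * 2 + 1) S W
      (Stores fun w (i : Fin M) =>
        (place (items (O w)) (level (O w)) (location n b B (O w) D) i, 0, 0))
      (fun w mem => HoldsEdges mem (edges w)) := by
  classical
  have hV2 : 2 * n < V := lt_of_le_of_lt (Nat.le_mul_of_pos_right _ (by omega)) hV
  let loc : Ω → ℕ → ℕ := fun w => location n b B (O w) D
  let A : Ω → Fin M → Multiset (ℕ × ℕ) := fun w i => place (items (O w)) (level (O w)) (loc w) i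
  let κ : Ω → ℕ → ℕ := fun w j => level (O w) j * (2 * n) + j
  have hκ : ∀ w, ∀ j ∈ items (O w), κ w j + 1 < V := fun w j hj => by
    have h1 := Nat.mul_le_mul_right (2 * n) (Nat.succ_le_of_lt (level_lt (hO w) hj))
    have h2 := lt_of_mem_items (hO w) hj
    rw [Nat.succ_mul, mul_comm n] at h1
    simp only [κ]
    omega
  have hmono : ∀ w, ∀ y ∈ items (O w), ∀ y' ∈ items (O w), loc w y < loc w y' → κ w y < κ w y' := by
    intro w y hy y' hy' h
    have := location_mono h
    rwa [sortKey_eq hnD (hO w) hy, sortKey_eq hnD (hO w) hy'] at this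
  let a : Ω → Fin M → ℕ → ℕ := fun w i _ =>
    (((items (O w)).filter fun j => loc w j = i).filter fun j => j % 2 = 1).sup fun j => κ w j + 1
  have ha : ∀ w w' i, A w i = A w' i → ∀ u, a w i u = a w' i u := by
    intro w w' i hA u
    have h1 := filter_eq_of_place_eq hA
    simp only [a, ← h1]
    refine Finset.sup_congr rfl fun j hj => ?_
    simp only [κ, height_eq_of_place_eq hA (Finset.filter_subset _ _ hj)]
  have hsup : ∀ w u (t : Finset (Fin M)), (t.sup fun k => a w k u) < V := by
    intro w u t
    refine (Finset.sup_lt_iff (by simp; omega)).2 fun k _ => ?_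
    refine (Finset.sup_lt_iff (by simp; omega)).2 fun j hj => ?_
    exact hκ w j (Finset.filter_subset _ _ (Finset.filter_subset _ _ hj))
  have hAc : ∀ w i, (A w i).card ≤ 2 * B := fun w i => by
    rw [card_place]; exact card_location_le hB (hO w) D i
  have hAV : ∀ w i, ∀ x ∈ A w i, x.1 < V ∧ x.2 < V := fun w i x hx => by
    obtain ⟨h1, -, h3⟩ := mem_place.1 hx
    have h4 := level_lt (hO w) h1
    have h5 := lt_of_mem_items (hO w) h1
    exact ⟨by rw [h3]; omega, by omega⟩
  let pre : Ω → Fin M → ℕ → ℕ := fun w i u => (Finset.univ.filter fun k => k < i).sup fun k => a w k u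
  have s₁ : Steps (2 + D * 2) S V (fun w i => (A w i, 0, 0))
      (fun w i => (A w i, 0, table 1 (pre w i))) :=
    Steps.scan (S₀ := 2 * B) (Equiv.refl _) Multiset.sup (fun x => Multiset.sup_singleton)
      multisetSup_bind A
      (fun _ _ => 0) a (fun w w' i h1 _ u _ => ha w w' i h1 u) (by omega) (by omega) hb
      (by omega) hM
      (fun w i => ⟨by simpa [Registers.size] using hAc w i, hAV w i, by simp, by simp⟩)
      (fun w v _ t => hsup w v t)
  -- The machines are in sorted order: all parent items on earlier machines precede `j`, and none on
  -- later machines do.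
  have hlast : ∀ w (i : Fin M), ∀ j ∈ (items (O w)).filter fun j => loc w j = i,
      lastParentKey n (O w) j = max (pre w i 0) ((((items (O w)).filter fun j => loc w j = i).filter
        fun y => y % 2 = 1 ∧ κ w y < κ w j).sup fun y => κ w y + 1) := by
    intro w i j hj
    obtain ⟨hj, hji⟩ := Finset.mem_filter.1 hj
    refine le_antisymm (Finset.sup_le fun y hy => ?_) (max_le (Finset.sup_le fun k hk =>
      Finset.sup_le fun y hy => ?_) (Finset.sup_le fun y hy => ?_))
    · obtain ⟨hy, hodd, hlt⟩ := Finset.mem_filter.1 hy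
      rcases lt_trichotomy (loc w y) (loc w j) with h | h | h
      · refine le_max_of_le_left ?_
        have hl := location_lt hB (hO w) (hOn w) hMB D hy (b := b)
        refine le_trans ?_ (Finset.le_sup (f := fun k => a w k 0)
          (show (⟨loc w y, hl⟩ : Fin M) ∈ Finset.univ.filter fun k => k < i from
            Finset.mem_filter.2 ⟨Finset.mem_univ _, show loc w y < i from hji ▸ h⟩))
        exact Finset.le_sup (f := fun y => κ w y + 1)
          (Finset.mem_filter.2 ⟨Finset.mem_filter.2 ⟨hy, rfl⟩, hodd⟩)
      · refine le_max_of_le_right (Finset.le_sup (f := fun y => κ w y + 1) ?_)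
        simp only [Finset.mem_filter]
        exact ⟨⟨hy, h.trans hji⟩, hodd, hlt⟩
      · exact absurd (hmono w j hj y hy h) hlt.not_gt
    · simp only [Finset.mem_filter, Finset.mem_univ, true_and] at hk hy
      refine Finset.le_sup (f := fun y => κ w y + 1) ?_
      rw [Finset.mem_filter]
      refine ⟨hy.1.1, hy.2, hmono w y hy.1.1 j hj ?_⟩
      rw [hy.1.2, hji]
      exact hk
    · simp only [Finset.mem_filter] at hy
      refine Finset.le_sup (f := fun y => κ w y + 1) ?_
      rw [Finset.mem_filter]
      exact ⟨hy.1.1, hy.2⟩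
  refine (Realizes.mono s₁ le_rfl hVW).trans (Realizes.output (fun w i =>
    ((items (O w)).filter fun j => loc w j = i ∧ j % 2 = 0).val.map
      fun j => (j / 2, foundParent n (O w) j)) edges (by omega) hVW
    (fun w i => ⟨?_, hAV w i, by simp, fun x hx => ?_⟩) (fun w w' i hi => ?_) (fun w i => ?_)
    (fun w i e he => ?_) fun w => ?_)
  · have := hAc w i
    simp only [Registers.size, card_table, Multiset.card_zero]
    omega
  · obtain ⟨h1, h2⟩ := mem_table.1 hx
    exact ⟨by omega, h2 ▸ hsup w 0 _⟩
  · simp only [Prod.mk.injEq] at hi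
    obtain ⟨h1, -, h3⟩ := hi
    have hF := filter_eq_of_place_eq h1
    have hh := fun j hj => height_eq_of_place_eq h1 (j := j) hj
    have hκκ : ∀ j ∈ (items (O w)).filter fun j => loc w j = i, κ w j = κ w' j := fun j hj => by
      simp only [κ, hh j hj]
    have hp := eq_of_table_eq h3 zero_lt_one
    simp only [← Finset.filter_filter, loc, ← hF]
    refine Multiset.map_congr rfl fun j hj => ?_
    have hj : j ∈ (items (O w)).filter fun j => loc w j = i := Finset.filter_subset _ _ hj
    rw [foundParent, foundParent, hlast w i j hj, hlast w' i j (hF ▸ hj), hp]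
    simp only [loc, ← hF]
    congr 5
    rw [← hκκ j hj, Finset.filter_congr fun y hy => by rw [hκκ y hy]]
    refine Finset.sup_congr rfl fun y hy => ?_
    rw [hκκ y (Finset.filter_subset _ _ hy)]
  · have h1 := card_location_le (b := b) hB (hO w) D i
    have h2 : ((items (O w)).filter fun j => loc w j = i ∧ j % 2 = 0).card ≤
        ((items (O w)).filter fun j => loc w j = i).card :=
      Finset.card_le_card fun j hj => by
        rw [Finset.mem_filter] at hj ⊢
        exact ⟨hj.1, hj.2.1⟩
    rw [Multiset.card_map]
    change 2 * Finset.card _ ≤ S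
    simp only [loc] at h2 ⊢
    omega
  · obtain ⟨j, hj, rfl⟩ := Multiset.mem_map.1 he
    have h1 := lt_of_mem_items (hO w) (Finset.filter_subset _ _ hj)
    have h2 := Nat.mod_lt (lastParentKey n (O w) j - 1) (show 0 < 2 * n by omega)
    have h3 : V ≤ W := (Nat.le_self_pow four_ne_zero V).trans hVW
    simp only [foundParent]
    omega
  · rw [hedges]
    exact sum_filter_map (fun j hj => location_lt hB (hO w) (hOn w) hMB D hj) _ _

end MPCAlgorithm

-- The edge list in terms of the parents found

namespace TagTree

/-- Each node but the root is the child of exactly one edge, and that edge is determined by its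
child through `foundParent_eq`. The root, at position `0`, drops out because item `0` is excluded.
-/
theorem coe_edges_eq (T : TagTree) {n : ℕ} (hT : T.tagString.length = n) :
    (T.edges : Multiset (ℕ × ℕ)) = ((items (openers T.tagString)).filter fun j => j % 2 = 0).val.map
      fun j => (j / 2, foundParent n (openers T.tagString) j) := by
  set O := openers T.tagString with hOdef
  have hO : ∀ p ∈ O, p < n := fun p hp => hT ▸ lt_length_of_mem_openers hp
  have h1 : ((items O).filter fun j => j % 2 = 0) = (O.erase 0).image (2 * ·) := by
    ext j
    simp only [Finset.mem_filter, mem_items, Finset.mem_image, Finset.mem_erase]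
    constructor
    · rintro ⟨⟨h1, h2⟩, h3⟩
      exact ⟨j / 2, ⟨by omega, h1⟩, by omega⟩
    · rintro ⟨p, ⟨h1, h2⟩, rfl⟩
      exact ⟨⟨by rwa [show 2 * p / 2 = p by omega], by omega⟩, by omega⟩
  rw [h1, Finset.image_val_of_injOn (fun p _ q _ h => by simpa using h), Multiset.map_map,
    ← map_fst_edges, Multiset.map_map]
  refine Eq.trans (Multiset.map_id _).symm (Multiset.map_congr rfl fun e he => ?_)
  obtain ⟨h2, h3, h4, h5⟩ := parent_spec T he
  have hc : e.1 ∈ O.erase 0 := by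
    rw [← Finset.mem_val, hOdef, ← map_fst_edges]
    exact Multiset.mem_map_of_mem _ he
  have h6 := foundParent_eq hO h2 (hO _ (Finset.mem_of_mem_erase hc)) h3 h4 h5
  simp [h6]

theorem mem_openers_iff_toWord (Z : List Token) (p : ℕ) :
    p ∈ openers Z ↔ ∃ x, (Z.map Token.toWord)[p]? = some x ∧ x % 2 = 1 := by
  have key : ∀ y : Token, y.toWord % 2 = 1 ↔ y.isOpen = true := fun y => by
    cases h : y.isOpen <;> simp [Token.toWord, h]
  rw [mem_openers, List.getElem?_map]
  cases Z[p]? <;> simp [key]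

end TagTree

-- Choice of the parameters and conclusion

/-- The fan-out of the communication pattern. -/
noncomputable def fanOut (δ : ℝ) (n : ℕ) : ℕ := ⌈(n : ℝ) ^ (δ / 2)⌉₊

theorem fanOut_pos (δ : ℝ) {n : ℕ} (hn : 2 ≤ n) : 0 < fanOut δ n :=
  Nat.ceil_pos.2 (Real.rpow_pos_of_pos (by positivity) _)

theorem chunkSize_pos (δ : ℝ) {n : ℕ} (hn : 2 ≤ n) : 0 < chunkSize δ n :=
  Nat.ceil_pos.2 (Real.rpow_pos_of_pos (by positivity) _)

/-- Rounding up at most doubles a number that is at least `1`; squaring this gives the factor `4`.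
-/
theorem fanOut_mul_self_le {δ : ℝ} (hδ0 : 0 < δ) {n : ℕ} (hn : 2 ≤ n) :
    fanOut δ n * fanOut δ n ≤ 4 * chunkSize δ n := by
  have hn1 : (1 : ℝ) ≤ n := by exact_mod_cast (by omega : 1 ≤ n)
  have h1 : (1 : ℝ) ≤ (n : ℝ) ^ (δ / 2) := Real.one_le_rpow hn1 (by positivity)
  have h2 : (fanOut δ n : ℝ) ≤ 2 * (n : ℝ) ^ (δ / 2) := by
    have := Nat.ceil_lt_add_one (zero_le_one.trans h1)
    unfold fanOut
    linarith
  have h3 : (n : ℝ) ^ (δ / 2) * (n : ℝ) ^ (δ / 2) = (n : ℝ) ^ δ := by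
    rw [← Real.rpow_add (by linarith), add_halves]
  have h4 : (n : ℝ) ^ δ ≤ chunkSize δ n := Nat.le_ceil _
  have h5 := mul_le_mul h2 h2 (Nat.cast_nonneg _) (by linarith)
  have : (fanOut δ n : ℝ) * fanOut δ n ≤ 4 * chunkSize δ n := by linarith
  exact_mod_cast this

theorem le_fanOut_pow {δ : ℝ} (hδ0 : 0 < δ) {n : ℕ} (hn : 2 ≤ n) :
    n ≤ fanOut δ n ^ ⌈2 / δ⌉₊ := by
  have hn1 : (1 : ℝ) ≤ n := by exact_mod_cast (by omega : 1 ≤ n)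
  have h1 : (1 : ℝ) ≤ (n : ℝ) ^ (δ / 2) := Real.one_le_rpow hn1 (by positivity)
  have : (n : ℝ) ≤ (fanOut δ n : ℝ) ^ ⌈2 / δ⌉₊ := by
    calc (n : ℝ) = ((n : ℝ) ^ (δ / 2)) ^ (2 / δ) := by
          rw [← Real.rpow_mul (by linarith), show δ / 2 * (2 / δ) = 1 by field_simp, Real.rpow_one]
      _ ≤ ((n : ℝ) ^ (δ / 2)) ^ ((⌈2 / δ⌉₊ : ℕ) : ℝ) :=
          Real.rpow_le_rpow_of_exponent_le h1 (Nat.le_ceil _)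
      _ = ((n : ℝ) ^ (δ / 2)) ^ ⌈2 / δ⌉₊ := Real.rpow_natCast _ _
      _ ≤ _ := pow_le_pow_left₀ (by linarith) (Nat.le_ceil _) _
  exact_mod_cast this

theorem fanOut_le {δ : ℝ} (hδ1 : δ < 1) {n : ℕ} (hn : 2 ≤ n) : fanOut δ n ≤ n := by
  have hn1 : (1 : ℝ) ≤ n := by exact_mod_cast (by omega : 1 ≤ n)
  refine Nat.ceil_le.2 ?_
  calc (n : ℝ) ^ (δ / 2) ≤ (n : ℝ) ^ (1 : ℝ) :=
        Real.rpow_le_rpow_of_exponent_le hn1 (by linarith)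
    _ = n := Real.rpow_one _

theorem le_machineCount_mul (δ : ℝ) {n : ℕ} (hn : 2 ≤ n) :
    n ≤ machineCount δ n * chunkSize δ n := by
  have := le_smul_ceilDiv (b := n) (chunkSize_pos δ hn)
  rwa [smul_eq_mul, mul_comm] at this

theorem machineCount_le (δ : ℝ) {n : ℕ} (hn : 2 ≤ n) : machineCount δ n ≤ n :=
  (ceilDiv_le_iff_le_smul (chunkSize_pos δ hn)).2
    (Nat.le_mul_of_pos_left n (chunkSize_pos δ hn))

/-- The number of rounds of the algorithm. -/
noncomputable def edgeRounds (δ : ℝ) : ℕ :=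
  let D := ⌈2 / δ⌉₊
  1 + (2 + D * 2 + 1) + D * (2 + D * 2 + 1 + (2 + D * 2) + 1) + (2 + D * 2 + 1)

open MPCAlgorithm in
/-- The edges of a tree can be found in a constant number of rounds. -/
theorem realizes_edges {δ : ℝ} (hδ0 : 0 < δ) (hδ1 : δ < 1) (a : ℕ) {n : ℕ} (hn : 2 ≤ n) :
    Realizes (M := machineCount δ n) (edgeRounds δ) (10 * chunkSize δ n) (n ^ (a + 17))
      (fun (T : {T : TagTree // T.tagString.length = n ∧ ∀ x ∈ T.tagString, x.tag < n ^ a}) mem =>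
        mem = distribute δ n (T.1.tagString.map Token.toWord))
      (fun T mem => HoldsEdges mem T.1.edges) := by
  have hB := chunkSize_pos δ hn
  have hb := fanOut_pos δ hn
  have hbb := fanOut_mul_self_le hδ0 hn
  have hb1 := Nat.le_mul_of_pos_left (fanOut δ n) hb
  have hMB := le_machineCount_mul δ hn
  have hnD := le_fanOut_pow hδ0 hn
  have hM := (machineCount_le δ hn).trans hnD
  -- Record entries are bounded by `n ^ 4`, which leaves room for the sort keys, of size up to `2 *
  -- n * n`.
  have hV : 2 * n * n < n ^ 4 := by
    calc 2 * n * n ≤ n * n * n := Nat.mul_le_mul_right _ (Nat.mul_le_mul_right _ hn)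
      _ = n ^ 3 := by ring
      _ < n ^ 4 := Nat.pow_lt_pow_right (by omega) (by omega)
  have hV2 : 2 * n < n ^ 4 := lt_of_le_of_lt (Nat.le_mul_of_pos_right _ (by omega)) hV
  -- Encoded records are below `n ^ 16` and input words below `n ^ (a + 1)`; the exponent `a + 17`
  -- covers both.
  have hVW : (n ^ 4) ^ 4 ≤ n ^ (a + 17) := by
    rw [← pow_mul]; exact Nat.pow_le_pow_right (by omega) (by omega)
  have hO : ∀ T : {T : TagTree // T.tagString.length = n ∧ ∀ x ∈ T.tagString, x.tag < n ^ a},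
      ∀ p ∈ openers T.1.tagString, p < n := fun T p hp =>
    T.2.1 ▸ TagTree.lt_length_of_mem_openers hp
  have hOn : ∀ T : {T : TagTree // T.tagString.length = n ∧ ∀ x ∈ T.tagString, x.tag < n ^ a},
      2 * (openers T.1.tagString).card ≤ n := fun T =>
    ((TagTree.two_mul_card_openers T.1).trans T.2.1).le
  have hA : ∀ T : {T : TagTree // T.tagString.length = n ∧ ∀ x ∈ T.tagString, x.tag < n ^ a},
      ∀ x ∈ T.1.tagString.map Token.toWord, x < n ^ (a + 17) := by
    intro T x hx
    obtain ⟨y, hy, rfl⟩ := List.mem_map.1 hx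
    have h1 := T.2.2 y hy
    have h2 : y.toWord ≤ 2 * y.tag + 1 := by
      unfold Token.toWord; split_ifs <;> omega
    calc y.toWord < 2 * n ^ a := by omega
      _ ≤ n * n ^ a := Nat.mul_le_mul_right _ hn
      _ = n ^ (a + 1) := (pow_succ' _ _).symm
      _ ≤ n ^ (a + 17) := Nat.pow_le_pow_right (by omega) (by omega)
  refine Realizes.trans (Realizes.trans (Realizes.trans ?_
    (Realizes.mono (Steps.makeItems _ hO hOn hn hB hMB hb hM hV2 ?_) le_rfl hVW))
    (Realizes.mono (Steps.sortItems _ hO hOn hn hB hMB hb hM (fanOut_le hδ1 hn) hV2 ?_ ⌈2 / δ⌉₊)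
      le_rfl hVW))
    (Realizes.findParents _ hO hOn hn hB hMB hb hM hnD hV hVW ?_ _
      fun T => T.1.coe_edges_eq T.2.1)
  · exact Realizes.input (n := n) (V := n ^ 4) _ _ hB (by omega)
      (fun T p => TagTree.mem_openers_iff_toWord _ p) hA (fun T => by simpa using T.2.1)
      (by omega) (by omega) hVW
  -- The largest space requirement is `2 * B + b + b * b` with `b ≤ b * b ≤ 4 * B`, hence the
  -- constant `10`.
  · omega
  · omega
  · omega

theorem mainTheorem4 (δ : ℝ) (hδ0 : 0 < δ) (hδ1 : δ < 1) :
    ∃ R C : ℕ, ∀ a : ℕ, ∃ c : ℕ, ∃ P : ∀ n : ℕ, MPCAlgorithm (machineCount δ n),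
      ∀ (n : ℕ) (T : TagTree), T.tagString.length = n →
        (∀ x ∈ T.tagString, x.tag < n ^ a) →
          (P n).WithinLimits (distribute δ n (T.tagString.map Token.toWord))
              R (C * chunkSize δ n) (n ^ c) ∧
            HoldsEdges ((P n).memory (distribute δ n (T.tagString.map Token.toWord)) R)
              T.edges := by
  have key : ∀ a n : ℕ, ∃ P : MPCAlgorithm (machineCount δ n), ∀ T : TagTree,
      T.tagString.length = n → (∀ x ∈ T.tagString, x.tag < n ^ a) →
        P.WithinLimits (distribute δ n (T.tagString.map Token.toWord)) (edgeRounds δ)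
            (10 * chunkSize δ n) (n ^ (a + 17)) ∧
          HoldsEdges (P.memory (distribute δ n (T.tagString.map Token.toWord)) (edgeRounds δ))
            T.edges := fun a n => by
    rcases Nat.lt_or_ge n 2 with hn | hn
    -- The string of a tree has positive even length, so no tree has `n < 2`.
    · refine ⟨⟨fun _ _ _ _ => []⟩, fun T hT => ?_⟩
      obtain ⟨b, s, hs⟩ := T.tagString_eq_cons
      have h1 := T.two_mul_card_openers
      have h2 : T.tagString.length = s.length + 1 := by rw [hs]; rfl
      omega
    · obtain ⟨P, hP⟩ := realizes_edges hδ0 hδ1 a hn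
      exact ⟨P, fun T hT hx => hP ⟨T, hT, hx⟩ _ rfl⟩
  refine ⟨edgeRounds δ, 10, fun a => ⟨a + 17, ?_⟩⟩
  choose P hP using key a
  exact ⟨P, hP⟩
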